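/- Notation. Let $n\ge 1$ and $\mathbb T^n=(\mathbb R/2\pi\mathbb Z)^n$; write $v=\sum_{j\in\mathbb Z^n}v_je^{ij\cdot x}$ for Fourier series on $\mathbb T^n$, let $A=\sqrt{I-\Delta}$ (symbol $(1+|j|^2)^{1/2}$), and for a fixed integer $1\le m\le n$ let $\mathscr A$ be the Fourier multiplier with symbol $|j'|$, $j'=(j_1,\dots,j_m)$. Let $\|v\|_{H^s}^2=\sum_j|v_j|^2(1+|j|^2)^s$ ($s\in\mathbb R$), and let $\mathcal D(A^qe^{\tau\mathscr A})$ be the set of $v\in L^2(\mathbb T^n)$ with $\|A^qe^{\tau\mathscr A}v\|^2:=\sum_j|v_j|^2(1+|j|^2)^qe^{2\tau|j'|}<\infty$. Let $p>\frac n2$, $p\ge1$, and $T,\lambda,\sigma>0$. Let $f(t,x,u)=\sum_{j\in\mathbb Z^n}\sum_{k\ge0}a_{jk}(t)u^ke^{ij\cdot x}$ with (complex) coefficients $a_{jk}$ continuous on $[0,T]$, such that the majorising series $$g(t,s)=\sum_{k\ge0}\sum_{j\in\mathbb Z^n}|a_{jk}(t)|(1+|j|^2)^{p/2}e^{\lambda|j'|}s^k$$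 converges for all $t\in[0,T]$, $s\in\mathbb R$, and $t\mapsto g(t,s)$ is continuous on $[0,T]$ for every $s\ge0$. Consider the problem $\Box u+u+f(t,x,u)=0$ on $\mathbb T^n$, $u(0)=u_0$, $u_t(0)=u_1$. A solution on $[0,T]$ is a (real- or complex-valued) $u\in C([0,T];H^p)$ with $u_t\in C([0,T];H^{p-1})$, $u_{tt}\in C([0,T];H^{p-2})$, $u(0)=u_0$, $u_t(0)=u_1$, and $\langle u_{tt},\phi\rangle+(Au,A\phi)+\langle f(t,x,u),\phi\rangle=0$ for all $\phi\in H^1$ and $t\in[0,T]$. Theorem. Let $C_0=2^p\big(2\sum_{j\in\mathbb Z^n}(1+|j|^2)^{-p}\big)^{1/2}$. There is a constant $C_1>0$ depending only on $n$ and $p$ such that the following holds for all $m,T,\lambda,\sigma,f$ as above. Let $u_0\in\mathcal D(A^{p+1}e^{\sigma\mathscr A})$, $u_1\in\mathcal D(A^pe^{\sigma\mathscr A})$, and let $u$ be a solution on $[0,T]$ (uniqueness of $u$ need not be assumed). Put $\tau_0=\min\{\sigma,\lambda\}$, $Y_0=\big(\|A^pe^{\tau_0\mathscr A}u_1\|^2+\|A^{p+1}e^{\tau_0\mathscr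 A}u_0\|^2\big)^{1/2}$ and $$\xi(t)=Y_0+C_1\int_0^tg\big(s,C_0(\sqrt2\,e\|u(s)\|_{H^p}+2)\big)\,ds,\qquad h(t)=C_1\,g\big(t,C_0(\sqrt2\,\xi(t)+1)\big)\,\xi(t).$$ Then $h$ is continuous and nonnegative on $[0,T]$; the problem $\tau'(t)=-\tau^3(t)h(t)$, $\tau(0)=\tau_0$ has exactly one solution on $[0,T]$, namely $$\tau(t)=\Big(2\int_0^th(s)\,ds+\tau_0^{-2}\Big)^{-1/2};$$ and $u(t)\in\mathcal D(A^{p+1}e^{\tau(t)\mathscr A})$, $u_t(t)\in\mathcal D(A^pe^{\tau(t)\mathscr A})$ for all $t\in[0,T]$. In particular, if $h(t)\le K(1+t)^\alpha$ on $[0,T]$ with $K,\alpha\ge0$, then $\tau(t)\ge(2K+\tau_0^{-2})^{-1/2}(1+t)^{-(\alpha+1)/2}$ on $[0,T]$. -/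

import Mathlib

open Set Filter Topology MeasureTheory

noncomputable section

namespace GevreyWave

/-- The normalised Haar (probability) measure on the torus.  The torus `(ℝ / 2πℤ)ⁿ` is parametrised
as `x = 2πθ` with `θ` in `UnitAddTorus (Fin n) = (ℝ / ℤ)ⁿ`; in this parametrisation the character
`e^{i j·x}` is `UnitAddTorus.mFourier j θ`, and Fourier coefficients, the multiplier
`A = (I - Δ_x)^{1/2}` (symbol `(1 + |j|²)^{1/2}`) and all the norms below are those of
`(ℝ / 2πℤ)ⁿ`. -/
abbrev torusMeasure (n : ℕ) : Measure (UnitAddTorus (Fin n)) :=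
  Measure.pi fun _ => AddCircle.haarAddCircle

/-- The complex Hilbert space `L²(𝕋ⁿ)`. -/
abbrev L2Torus (n : ℕ) : Type := Lp ℂ 2 (torusMeasure n)

/-- The family of Fourier coefficients `(v_j)` of `v ∈ L²(𝕋ⁿ)`. -/
def coeff {n : ℕ} (v : L2Torus n) : (Fin n → ℤ) → ℂ :=
  UnitAddTorus.mFourierCoeff (v : UnitAddTorus (Fin n) → ℂ)

/-- `1 + |j|²`, the symbol of `A² = I - Δ`. -/
def bracket {n : ℕ} (j : Fin n → ℤ) : ℝ := 1 + ∑ i, (j i : ℝ) ^ 2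

/-- `|j'|`, the Euclidean length of the first `m` components `j' = (j₁, …, j_m)` of `j`. -/
def absFirst {n : ℕ} (m : ℕ) (j : Fin n → ℤ) : ℝ :=
  Real.sqrt (∑ i with i.val < m, (j i : ℝ) ^ 2)

/-! ### Sobolev spaces and Gevrey-Sobolev classes

A periodic distribution is given by its family of Fourier coefficients. -/

/-- `c` is the family of Fourier coefficients of an element of `H^s(𝕋ⁿ)`, `s ∈ ℝ`. -/
def MemSobolev {n : ℕ} (s : ℝ) (c : (Fin n → ℤ) → ℂ) : Prop :=
  Summable fun j => ‖c j‖ ^ 2 * bracket j ^ s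

/-- The norm of `H^s(𝕋ⁿ)`. -/
def sobolevNorm {n : ℕ} (s : ℝ) (c : (Fin n → ℤ) → ℂ) : ℝ :=
  Real.sqrt (∑' j, ‖c j‖ ^ 2 * bracket j ^ s)

/-- `v ∈ 𝒟(A^q e^{τ𝒜})`, where `𝒜` has the symbol `|j'|`. -/
def MemGevrey {n : ℕ} (m : ℕ) (q τ : ℝ) (v : L2Torus n) : Prop :=
  Summable fun j => ‖coeff v j‖ ^ 2 * bracket j ^ q * Real.exp (2 * τ * absFirst m j)

/-- The norm `‖A^q e^{τ𝒜} v‖`. -/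
def gevreyNorm {n : ℕ} (m : ℕ) (q τ : ℝ) (v : L2Torus n) : ℝ :=
  Real.sqrt (∑' j, ‖coeff v j‖ ^ 2 * bracket j ^ q * Real.exp (2 * τ * absFirst m j))

/-- `c ∈ C([0,T]; H^s)`. -/
def ContinuousInSobolev {n : ℕ} (T s : ℝ) (c : ℝ → (Fin n → ℤ) → ℂ) : Prop :=
  (∀ t ∈ Icc 0 T, MemSobolev s (c t)) ∧
  ∀ t ∈ Icc 0 T, Tendsto (fun r => sobolevNorm s (c r - c t)) (𝓝[Icc 0 T] t) (𝓝 0)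

/-- `d` is the time derivative of `c` on `[0,T]`, the difference quotients converging in `H^s`
(one-sided at the end points). -/
def HasTimeDeriv {n : ℕ} (T s : ℝ) (c d : ℝ → (Fin n → ℤ) → ℂ) : Prop :=
  ∀ t ∈ Icc 0 T,
    Tendsto (fun r => sobolevNorm s ((r - t)⁻¹ • (c r - c t) - d t))
      (𝓝[Icc 0 T \ {t}] t) (𝓝 0)

/-! ### The nonlinearity

It is given by its coefficients `a j k : ℝ → ℂ` (`j ∈ ℤⁿ`, `k ∈ ℕ`), which are functions of
time. -/

/-- `f(t,x,z) = ∑_j (∑_k a_{jk}(t) z^k) e^{i j·x}`. -/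
def nonlinearity {n : ℕ} (a : (Fin n → ℤ) → ℕ → ℝ → ℂ) (t : ℝ) (x : UnitAddTorus (Fin n))
    (z : ℂ) : ℂ :=
  ∑' j, (∑' k, a j k t * z ^ k) * UnitAddTorus.mFourier j x

/-- The term of index `(k, j)` of the majorising series. -/
def majorantTerm {n : ℕ} (m : ℕ) (p lam : ℝ) (a : (Fin n → ℤ) → ℕ → ℝ → ℂ) (t s : ℝ)
    (q : ℕ × (Fin n → ℤ)) : ℝ :=
  ‖a q.2 q.1 t‖ * bracket q.2 ^ (p / 2) * Real.exp (lam * absFirst m q.2) * s ^ q.1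

/-- The majorising function
`g(t,s) = ∑_k ∑_j |a_{jk}(t)| (1 + |j|²)^{p/2} e^{λ|j'|} s^k`. -/
def majorant {n : ℕ} (m : ℕ) (p lam : ℝ) (a : (Fin n → ℤ) → ℕ → ℝ → ℂ) (t s : ℝ) : ℝ :=
  ∑' q, majorantTerm m p lam a t s q

/-- The assumption on the nonlinearity on the time interval `[0,T]`: the `a_{jk}` are continuous,
the majorising series converges for every `s`, and its sum depends continuously on time. -/
structure MajorantAssumption {n : ℕ} (m : ℕ) (p lam T : ℝ) (a : (Fin n → ℤ) → ℕ → ℝ → ℂ) :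
    Prop where
  continuousOn_coeff : ∀ j k, ContinuousOn (a j k) (Icc 0 T)
  summable : ∀ t ∈ Icc 0 T, ∀ s : ℝ, Summable (majorantTerm m p lam a t s)
  continuousOn_majorant : ∀ s : ℝ, 0 ≤ s → ContinuousOn (fun t => majorant m p lam a t s) (Icc 0 T)

/-! ### Solutions -/

/-- `⟨w, φ⟩ + (A v, A φ) + ⟨f(t, x, v), φ⟩ = 0` for all `φ ∈ H¹`, where `w` (a distribution given
by its Fourier coefficients) stands for `u_tt` and `v` for `u`, at the time `t`. -/
def WeakEquation {n : ℕ} (a : (Fin n → ℤ) → ℕ → ℝ → ℂ) (t : ℝ) (v : L2Torus n)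
    (w : (Fin n → ℤ) → ℂ) : Prop :=
  ∀ φ : L2Torus n, MemSobolev 1 (coeff φ) →
    (∑' j, w j * star (coeff φ j)) + (∑' j, (bracket j : ℂ) * coeff v j * star (coeff φ j)) +
      ∫ x, nonlinearity a t x (v x) * star (φ x) ∂torusMeasure n = 0

/-- `u`, with time derivative `ut`, is a solution on `[0,T]` of
`□u + u + f(t,x,u) = 0`, `u(0) = u₀`, `u_t(0) = u₁`, of regularity `u ∈ C([0,T]; H^p)`,
`u_t ∈ C([0,T]; H^{p-1})`, `u_tt ∈ C([0,T]; H^{p-2})`. -/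
def IsSolution {n : ℕ} (a : (Fin n → ℤ) → ℕ → ℝ → ℂ) (T p : ℝ) (u₀ u₁ : L2Torus n)
    (u ut : ℝ → L2Torus n) : Prop :=
  u 0 = u₀ ∧ ut 0 = u₁ ∧
  ContinuousInSobolev T p (fun t => coeff (u t)) ∧
  ContinuousInSobolev T (p - 1) (fun t => coeff (ut t)) ∧
  HasTimeDeriv T (p - 1) (fun t => coeff (u t)) (fun t => coeff (ut t)) ∧
  ∃ utt : ℝ → (Fin n → ℤ) → ℂ,
    ContinuousInSobolev T (p - 2) utt ∧
    HasTimeDeriv T (p - 2) (fun t => coeff (ut t)) utt ∧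
    ∀ t ∈ Icc 0 T, WeakEquation a t (u t) (utt t)

/-! ### The radius of analyticity -/

/-- The constant `C₀ = 2^p (2 ∑_j (1 + |j|²)^{-p})^{1/2}` of the product estimate in
`𝒟(A^p e^{τ𝒜})`. -/
def algebraConst (n : ℕ) (p : ℝ) : ℝ :=
  2 ^ p * Real.sqrt (2 * ∑' j : Fin n → ℤ, bracket j ^ (-p))

/-- `Y₀ = (‖A^p e^{τ₀𝒜} u₁‖² + ‖A^{p+1} e^{τ₀𝒜} u₀‖²)^{1/2}`. -/
def initialSize {n : ℕ} (m : ℕ) (p τ₀ : ℝ) (u₀ u₁ : L2Torus n) : ℝ :=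
  Real.sqrt (gevreyNorm m p τ₀ u₁ ^ 2 + gevreyNorm m (p + 1) τ₀ u₀ ^ 2)

/-- `ξ(t) = Y₀ + C₁ ∫₀ᵗ g(s, C₀(√2 e ‖u(s)‖_{H^p} + 2)) ds`. -/
def xi {n : ℕ} (C₁ : ℝ) (m : ℕ) (p lam τ₀ : ℝ) (a : (Fin n → ℤ) → ℕ → ℝ → ℂ)
    (u₀ u₁ : L2Torus n) (u : ℝ → L2Torus n) (t : ℝ) : ℝ :=
  initialSize m p τ₀ u₀ u₁ + C₁ * ∫ s in (0 : ℝ)..t,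
    majorant m p lam a s
      (algebraConst n p * (Real.sqrt 2 * Real.exp 1 * sobolevNorm p (coeff (u s)) + 2))

/-- `h(t) = C₁ g(t, C₀(√2 ξ(t) + 1)) ξ(t)`. -/
def decayRate {n : ℕ} (C₁ : ℝ) (m : ℕ) (p lam τ₀ : ℝ) (a : (Fin n → ℤ) → ℕ → ℝ → ℂ)
    (u₀ u₁ : L2Torus n) (u : ℝ → L2Torus n) (t : ℝ) : ℝ :=
  C₁ * majorant m p lam a t
    (algebraConst n p * (Real.sqrt 2 * xi C₁ m p lam τ₀ a u₀ u₁ u t + 1)) *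
      xi C₁ m p lam τ₀ a u₀ u₁ u t

/-- `(2 ∫₀ᵗ h(s) ds + τ₀^{-2})^{-1/2}`. -/
def radius (h : ℝ → ℝ) (τ₀ t : ℝ) : ℝ :=
  (2 * (∫ s in (0 : ℝ)..t, h s) + τ₀ ^ (-2 : ℝ)) ^ (-(1 / 2) : ℝ)

/-- `τ` solves `τ' = -τ³ h` on `[0,T]`, `τ(0) = τ₀`. -/
def SolvesRadiusODE (h : ℝ → ℝ) (τ₀ T : ℝ) (τ : ℝ → ℝ) : Prop :=
  τ 0 = τ₀ ∧ ∀ t ∈ Icc 0 T, HasDerivWithinAt τ (-(τ t) ^ 3 * h t) (Icc 0 T) t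

end GevreyWave

end

/-!
The proof is an energy estimate for the solution `u` itself, in the norm of `𝒟(A^p e^{τ𝒜})`, with a
radius `τ` that shrinks fast enough for the dissipation it creates to absorb the nonlinearity.

*Nonlinearity.* For `p > n/2`, `p ≥ 1`, the space `𝒟(A^p e^{τ𝒜})` is an algebra with constant `C₀`
(`tsum_gevreyWeight_convolution_sq_le`): by Cauchy-Schwarz this is the pointwise inequality
`gevreyWeight_add_sq_le` for the weights. Expanding the power series gives
`‖f(t, ·, u)‖ ≤ g(t, C₀ ‖u‖)` (`sum_norm_mFourierCoeff_nonlinearity_le`).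

*Energy.* Let `Y² = ‖A^p e^{τ𝒜} u_t‖² + ‖A^{p+1} e^{τ𝒜} u‖²`, let `Z²` be the same quantity with an
additional factor `𝒜^{1/2}`, and let `τ' = -τ³ h`. Then
`(Y²)' ≤ -2 τ³ h Z² + 2 g(t, C₀ ‖A^p e^{τ𝒜} u‖) Y`. From `e^{2x} ≤ e² + x³ e^{2x}` one has
`‖A^p e^{τ𝒜} u‖² ≤ e² ‖u‖_{H^p}² + τ³ Z²` (`sum_gevreyWeight_sq_le_sobolevNorm`). If `τ³ Z² ≤ 1`,
the nonlinear term is at most `2 g(t, C₀ (√2 e ‖u‖_{H^p} + 2)) Y`, which is what the growth of `ξ`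
allows. If `τ³ Z² > 1`, then, as long as `Y` does not exceed `ξ` noticeably, the nonlinear term is
at most `2 τ³ Z² g(t, C₀ (√2 ξ + 1)) Y`, and `h` is chosen such that the dissipation absorbs it.
Hence `Y ≤ ξ` on `[0, T]`; one can take `C₁ = 2`.

*Regularisation.* A priori `u` is only in `H^p`, so `Y` might be infinite. The symbol `|j'|` is
replaced by `min(|j'|, N)`, which is still subadditive, so that the algebra property survives, while
the weighted norm of `u` becomes finite; and the energy is restricted to a finite set `S` of
frequencies, so that it is differentiable by the equations of finitely many Fourier coefficients.
For fixed `N` the frequencies outside `S` contribute little to the weighted norm of `u`, uniformly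
in time, by compactness of `[0, T]` and continuity of `u` in `H^p`
(`ContinuousInSobolev.exists_tail_le`). The comparison `truncEnergy_le` of the truncated energy with
`(ξ + ε (1 + t))²` is uniform in `N` and `S`, and the limit gives the regularity
(`memGevrey_of_truncEnergy_le`).

The equation `τ' = -τ³ h` is integrated explicitly, and is uniquely solvable because its right-hand
side is locally Lipschitz. The continuity of `h` comes from that of `g`, which is continuous in each
variable and monotone in the second one (`MajorantAssumption.continuousOn_majorant_comp`).
-/

noncomputable section

open scoped ENNReal NNReal

namespace GevreyWave

/-! ### Symbols and weights -/

lemma one_le_bracket {n : ℕ} (j : Fin n → ℤ) : 1 ≤ bracket j :=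
  le_add_of_nonneg_right (Finset.sum_nonneg fun _ _ => sq_nonneg _)

lemma bracket_pos {n : ℕ} (j : Fin n → ℤ) : 0 < bracket j := one_pos.trans_le (one_le_bracket j)

lemma absFirst_nonneg {n : ℕ} (m : ℕ) (j : Fin n → ℤ) : 0 ≤ absFirst m j := Real.sqrt_nonneg _

lemma absFirst_sq_le_bracket {n : ℕ} (m : ℕ) (j : Fin n → ℤ) : absFirst m j ^ 2 ≤ bracket j := by
  rw [absFirst, Real.sq_sqrt (Finset.sum_nonneg fun _ _ => sq_nonneg _), bracket]
  have : ∑ i with i.val < m, (j i : ℝ) ^ 2 ≤ ∑ i, (j i : ℝ) ^ 2 :=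
    Finset.sum_le_sum_of_subset_of_nonneg (Finset.filter_subset _ _) fun _ _ _ => sq_nonneg _
  linarith

lemma sqrt_sum_add_sq_le {ι : Type*} (s : Finset ι) (f g : ι → ℝ) :
    √(∑ i ∈ s, (f i + g i) ^ 2) ≤ √(∑ i ∈ s, f i ^ 2) + √(∑ i ∈ s, g i ^ 2) := by
  refine Real.sqrt_le_iff.2 ⟨by positivity, ?_⟩
  have hf : 0 ≤ ∑ i ∈ s, f i ^ 2 := Finset.sum_nonneg fun _ _ => sq_nonneg _
  have hg : 0 ≤ ∑ i ∈ s, g i ^ 2 := Finset.sum_nonneg fun _ _ => sq_nonneg _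
  have h := Real.sum_mul_le_sqrt_mul_sqrt s f g
  have e : ∑ i ∈ s, (f i + g i) ^ 2 = ∑ i ∈ s, f i ^ 2 + ∑ i ∈ s, g i ^ 2
      + 2 * ∑ i ∈ s, f i * g i := by
    rw [Finset.mul_sum, ← Finset.sum_add_distrib, ← Finset.sum_add_distrib]
    exact Finset.sum_congr rfl fun _ _ => by ring
  rw [e, add_sq, Real.sq_sqrt hf, Real.sq_sqrt hg]
  linarith

lemma absFirst_add_le {n : ℕ} (m : ℕ) (j l : Fin n → ℤ) :
    absFirst m (j + l) ≤ absFirst m j + absFirst m l := by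
  simpa [absFirst] using sqrt_sum_add_sq_le _ (fun i => (j i : ℝ)) (fun i => (l i : ℝ))

lemma sqrt_bracket_add_le {n : ℕ} (j l : Fin n → ℤ) :
    √(bracket (j + l)) ≤ √(bracket j) + √(bracket l) := by
  have h := sqrt_sum_add_sq_le Finset.univ (fun i : Option (Fin n) => i.elim 1 fun i => (j i : ℝ))
    (fun i : Option (Fin n) => i.elim 1 fun i => (l i : ℝ))
  simp only [Fintype.sum_option, Option.elim, one_pow] at h
  refine le_trans (Real.sqrt_le_sqrt ?_) h
  simp only [bracket, Pi.add_apply, Int.cast_add]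
  gcongr
  norm_num

lemma bracket_rpow_add_le {n : ℕ} {p : ℝ} (hp : 1 ≤ p) (j l : Fin n → ℤ) :
    bracket (j + l) ^ (p / 2) ≤ 2 ^ (p - 1) * (bracket j ^ (p / 2) + bracket l ^ (p / 2)) := by
  have e (k : Fin n → ℤ) : bracket k ^ (p / 2) = √(bracket k) ^ p := by
    rw [Real.sqrt_eq_rpow, ← Real.rpow_mul (bracket_pos k).le]; ring_nf
  rw [e, e, e]
  refine (Real.rpow_le_rpow (Real.sqrt_nonneg _) (sqrt_bracket_add_le j l) (by linarith)).trans ?_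
  have := NNReal.rpow_add_le_mul_rpow_add_rpow (Real.toNNReal √(bracket j))
    (Real.toNNReal √(bracket l)) hp
  have := NNReal.coe_le_coe.2 this
  simpa using this

/-- The symbol `min |j'| N` of a bounded truncation of `𝒜`. -/
def cutoff {n : ℕ} (m : ℕ) (N : ℝ) (j : Fin n → ℤ) : ℝ := min (absFirst m j) N

lemma cutoff_nonneg {n : ℕ} (m : ℕ) {N : ℝ} (hN : 0 ≤ N) (j : Fin n → ℤ) : 0 ≤ cutoff m N j :=
  le_min (absFirst_nonneg m j) hN

lemma cutoff_add_le {n : ℕ} (m : ℕ) {N : ℝ} (hN : 0 ≤ N) (j l : Fin n → ℤ) :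
    cutoff m N (j + l) ≤ cutoff m N j + cutoff m N l := by
  have h := absFirst_add_le m j l
  have := absFirst_nonneg m j
  have := absFirst_nonneg m l
  unfold cutoff
  rcases min_cases (absFirst m j) N with h1 | h1 <;> rcases min_cases (absFirst m l) N with h2 | h2
    <;> rcases min_cases (absFirst m (j + l)) N with h3 | h3 <;> linarith

/-- The symbol `(1 + |j|²)^{p/2} e^{τ min(|j'|, N)}` of the truncation of `A^p e^{τ𝒜}`. -/
def gevreyWeight {n : ℕ} (m : ℕ) (p τ N : ℝ) (j : Fin n → ℤ) : ℝ :=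
  bracket j ^ (p / 2) * Real.exp (τ * cutoff m N j)

lemma gevreyWeight_pos {n : ℕ} (m : ℕ) (p τ N : ℝ) (j : Fin n → ℤ) : 0 < gevreyWeight m p τ N j :=
  mul_pos (Real.rpow_pos_of_pos (bracket_pos j) _) (Real.exp_pos _)

lemma bracket_rpow_half_sq {n : ℕ} (p : ℝ) (j : Fin n → ℤ) :
    (bracket j ^ (p / 2)) ^ 2 = bracket j ^ p := by
  rw [← Real.rpow_natCast, ← Real.rpow_mul (bracket_pos j).le]; norm_num

lemma gevreyWeight_sq {n : ℕ} (m : ℕ) (p τ N : ℝ) (j : Fin n → ℤ) :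
    gevreyWeight m p τ N j ^ 2 = bracket j ^ p * Real.exp (2 * τ * cutoff m N j) := by
  rw [gevreyWeight, mul_pow, bracket_rpow_half_sq, ← Real.exp_nat_mul]
  congr 2; push_cast; ring

/-- The pointwise form of the algebra property: after division by the weights of the factors, the
weight of a product is square summable over the decompositions of a frequency. -/
lemma gevreyWeight_add_sq_le {n : ℕ} (m : ℕ) {p τ N : ℝ} (hp : 1 ≤ p) (hτ : 0 ≤ τ) (hN : 0 ≤ N)
    (j l : Fin n → ℤ) :
    gevreyWeight m p τ N (j + l) ^ 2 ≤ 2 ^ (2 * p - 1) * (bracket j ^ (-p) + bracket l ^ (-p)) *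
      (gevreyWeight m p τ N j ^ 2 * gevreyWeight m p τ N l ^ 2) := by
  have hb := bracket_rpow_add_le hp j l
  have e1 : Real.exp (τ * cutoff m N (j + l)) ≤
      Real.exp (τ * cutoff m N j) * Real.exp (τ * cutoff m N l) := by
    rw [← Real.exp_add, ← mul_add]
    exact Real.exp_le_exp.2 (mul_le_mul_of_nonneg_left (cutoff_add_le m hN j l) hτ)
  have hx : 0 < bracket j ^ (p / 2) := Real.rpow_pos_of_pos (bracket_pos j) _
  have hy : 0 < bracket l ^ (p / 2) := Real.rpow_pos_of_pos (bracket_pos l) _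
  have c2 : (2 : ℝ) ^ (2 * p - 1) = 2 * (2 ^ (p - 1)) ^ 2 := by
    rw [← Real.rpow_natCast, ← Real.rpow_mul (by norm_num)]
    rw [show 2 * p - 1 = 1 + (p - 1) * (2 : ℕ) by push_cast; ring, Real.rpow_add (by norm_num),
      Real.rpow_one]
  have hj : bracket j ^ (-p) = ((bracket j ^ (p / 2)) ^ 2)⁻¹ := by
    rw [bracket_rpow_half_sq, Real.rpow_neg (bracket_pos j).le]
  have hl : bracket l ^ (-p) = ((bracket l ^ (p / 2)) ^ 2)⁻¹ := by
    rw [bracket_rpow_half_sq, Real.rpow_neg (bracket_pos l).le]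
  rw [hj, hl, c2]
  unfold gevreyWeight
  have h0 : 0 ≤ bracket (j + l) ^ (p / 2) := (Real.rpow_pos_of_pos (bracket_pos _) _).le
  generalize bracket (j + l) ^ (p / 2) = z at *
  generalize bracket j ^ (p / 2) = x at *
  generalize bracket l ^ (p / 2) = y at *
  generalize Real.exp (τ * cutoff m N j) = E at *
  generalize Real.exp (τ * cutoff m N l) = F at *
  have hG : 0 < Real.exp (τ * cutoff m N (j + l)) := Real.exp_pos _
  generalize Real.exp (τ * cutoff m N (j + l)) = G at *
  have hc : (0 : ℝ) < 2 ^ (p - 1) := Real.rpow_pos_of_pos (by norm_num) _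
  generalize (2 : ℝ) ^ (p - 1) = c at *
  calc (z * G) ^ 2 ≤ ((c * (x + y)) * (E * F)) ^ 2 := by gcongr
    _ = c ^ 2 * (x + y) ^ 2 * (E * F) ^ 2 := by ring
    _ ≤ c ^ 2 * (2 * (x ^ 2 + y ^ 2)) * (E * F) ^ 2 := by
        gcongr; nlinarith [sq_nonneg (x - y)]
    _ = _ := by field_simp; ring

lemma summable_bracket_rpow_neg {n : ℕ} {p : ℝ} (hpn : (n : ℝ) / 2 < p) :
    Summable fun j : Fin n → ℤ => bracket j ^ (-p) := by
  have hp : 0 < p := lt_of_le_of_lt (by positivity) hpn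
  let L : Submodule ℤ (Fin n → ℝ) := Submodule.span ℤ (Set.range (Pi.basisFun ℝ (Fin n)))
  have hmem (j : Fin n → ℤ) : (fun i => (j i : ℝ)) ∈ L := by
    rw [(Pi.basisFun ℝ (Fin n)).mem_span_iff_repr_mem ℤ]
    exact fun i => ⟨j i, by simp⟩
  let f : (Fin n → ℤ) → L := fun j => ⟨fun i => (j i : ℝ), hmem j⟩
  have hf : Function.Injective f := fun j l h => by
    ext i
    exact Int.cast_injective (α := ℝ) (congrFun (congrArg Subtype.val h) i)
  have hr : Module.finrank ℤ L = n := by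
    rw [ZLattice.rank ℝ L]; simp
  have hs := (ZLattice.summable_norm_rpow L (-(2 * p)) (by rw [hr]; linarith)).comp_injective hf
  refine Summable.of_norm_bounded_eventually hs ?_
  filter_upwards [(Set.finite_singleton (0 : Fin n → ℤ)).compl_mem_cofinite] with j hj
  have hj0 : f j ≠ 0 := fun h => hj (hf (h.trans (by ext; simp [f])))
  have hpos : 0 < ‖f j‖ := norm_pos_iff.2 hj0
  have hle : ‖f j‖ ^ 2 ≤ bracket j := by
    obtain ⟨i, hi⟩ : ∃ i, ‖f j‖ ≤ |(j i : ℝ)| := by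
      by_contra! h
      exact lt_irrefl _ ((pi_norm_lt_iff hpos).2 fun i => h i)
    calc ‖f j‖ ^ 2 ≤ |(j i : ℝ)| ^ 2 := by gcongr
      _ = (j i : ℝ) ^ 2 := sq_abs _
      _ ≤ ∑ i, (j i : ℝ) ^ 2 :=
        Finset.single_le_sum (f := fun i => (j i : ℝ) ^ 2) (fun _ _ => sq_nonneg _)
          (Finset.mem_univ i)
      _ ≤ bracket j := by unfold bracket; linarith
  rw [Real.norm_of_nonneg (Real.rpow_nonneg (bracket_pos j).le _)]
  calc bracket j ^ (-p) ≤ (‖f j‖ ^ 2) ^ (-p) :=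
        Real.rpow_le_rpow_of_nonpos (by positivity) hle (by linarith)
    _ = ‖f j‖ ^ (-(2 * p)) := by
        rw [← Real.rpow_natCast, ← Real.rpow_mul hpos.le]; congr 1; push_cast; ring

/-! ### Weighted `ℓ²` sequences form an algebra under convolution -/

lemma tsum_mul_sq_le {ι : Type*} (f g : ι → ℝ≥0∞) :
    (∑' i, f i * g i) ^ 2 ≤ (∑' i, f i ^ 2) * ∑' i, g i ^ 2 := by
  have key : ∑' i, f i * g i ≤ ((∑' i, f i ^ 2) * ∑' i, g i ^ 2) ^ (1 / 2 : ℝ) := by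
    rw [ENNReal.tsum_eq_iSup_sum]
    refine iSup_le fun s => ?_
    refine (ENNReal.inner_le_Lp_mul_Lq s f g Real.HolderConjugate.two_two).trans ?_
    rw [← ENNReal.mul_rpow_of_nonneg _ _ (by norm_num)]
    refine ENNReal.rpow_le_rpow ?_ (by norm_num)
    simp only [ENNReal.rpow_two]
    gcongr <;> exact ENNReal.sum_le_tsum s
  calc (∑' i, f i * g i) ^ 2 ≤ (((∑' i, f i ^ 2) * ∑' i, g i ^ 2) ^ (1 / 2 : ℝ)) ^ 2 := by gcongr
    _ = _ := by rw [← ENNReal.rpow_two, ← ENNReal.rpow_mul]; norm_num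

/-- The square of the weighted `ℓ²` norm of a family of coefficients; it is `∞` if the family is
not weighted square summable. -/
def weightedNormSq {ι : Type*} (w : ι → ℝ) (c : ι → ℂ) : ℝ≥0∞ :=
  ∑' j, (ENNReal.ofReal (w j) * ‖c j‖ₑ) ^ 2

/-- If `w (j + l)² ≤ K (r j + r l) w(j)² w(l)²` with `∑ r = R`, the weighted `ℓ²` space of weight
`w` is an algebra under convolution, with constant `(2 K R)^{1/2}`. -/
lemma tsum_convolution_sq_le {G : Type*} [AddCommGroup G] (w r : G → ℝ≥0∞) (K : ℝ≥0∞)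
    (h : ∀ j l, w (j + l) ^ 2 ≤ K * (r j + r l) * (w j ^ 2 * w l ^ 2)) (x y : G → ℝ≥0∞) :
    ∑' j, (w j * ∑' l, x l * y (j - l)) ^ 2 ≤
      K * (2 * ∑' l, r l) * ((∑' l, (w l * x l) ^ 2) * ∑' l, (w l * y l) ^ 2) := by
  have hsub (j : G) (z : G → ℝ≥0∞) : ∑' l, z (j - l) = ∑' l, z l :=
    (Equiv.subLeft j).tsum_eq z
  have hsub' (l : G) (z : G → ℝ≥0∞) : ∑' j, z (j - l) = ∑' j, z j :=
    (Equiv.subRight l).tsum_eq z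
  have hj (j : G) : (w j * ∑' l, x l * y (j - l)) ^ 2 ≤
      K * (2 * ∑' l, r l) * ∑' l, (w l * x l) ^ 2 * (w (j - l) * y (j - l)) ^ 2 := by
    have hterm (l : G) : w j * (x l * y (j - l)) ≤
        (K * (r l + r (j - l))) ^ (1 / 2 : ℝ) * ((w l * x l) * (w (j - l) * y (j - l))) := by
      have hw : w j ≤ (K * (r l + r (j - l))) ^ (1 / 2 : ℝ) * (w l * w (j - l)) := by
        have h1 := h l (j - l)
        rw [add_sub_cancel] at h1
        have h2 := ENNReal.rpow_le_rpow h1 (z := 1 / 2) (by norm_num)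
        rw [ENNReal.mul_rpow_of_nonneg _ _ (by norm_num), ← mul_pow, ← ENNReal.rpow_two,
          ← ENNReal.rpow_two, ← ENNReal.rpow_mul, ← ENNReal.rpow_mul] at h2
        norm_num at h2
        norm_num
        exact h2
      calc w j * (x l * y (j - l)) ≤
            ((K * (r l + r (j - l))) ^ (1 / 2 : ℝ) * (w l * w (j - l))) * (x l * y (j - l)) := by
              gcongr
        _ = _ := by ring
    calc (w j * ∑' l, x l * y (j - l)) ^ 2 = (∑' l, w j * (x l * y (j - l))) ^ 2 := by
          rw [ENNReal.tsum_mul_left]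
      _ ≤ (∑' l, (K * (r l + r (j - l))) ^ (1 / 2 : ℝ) *
            ((w l * x l) * (w (j - l) * y (j - l)))) ^ 2 := by
          exact pow_le_pow_left' (ENNReal.tsum_le_tsum hterm) 2
      _ ≤ _ := tsum_mul_sq_le _ _
      _ = _ := by
          congr 1
          · simp only [← ENNReal.rpow_two, ← ENNReal.rpow_mul]
            norm_num
            rw [ENNReal.tsum_mul_left, ENNReal.tsum_add, hsub j r, two_mul]
          · simp only [mul_pow]
  calc ∑' j, (w j * ∑' l, x l * y (j - l)) ^ 2
      ≤ ∑' j, K * (2 * ∑' l, r l) * ∑' l, (w l * x l) ^ 2 * (w (j - l) * y (j - l)) ^ 2 :=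
        ENNReal.tsum_le_tsum hj
    _ = _ := by
        rw [ENNReal.tsum_mul_left, ENNReal.tsum_comm]
        congr 1
        simp_rw [ENNReal.tsum_mul_left]
        simp_rw [hsub' _ fun k => (w k * y k) ^ 2]
        rw [ENNReal.tsum_mul_right]

/-- The algebra property of the Gevrey-Sobolev classes, with the constant `C₀`. -/
lemma tsum_gevreyWeight_convolution_sq_le {n : ℕ} (m : ℕ) {p τ N : ℝ} (hpn : (n : ℝ) / 2 < p)
    (hp : 1 ≤ p) (hτ : 0 ≤ τ) (hN : 0 ≤ N) (x y : (Fin n → ℤ) → ℝ≥0∞) :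
    ∑' j, (ENNReal.ofReal (gevreyWeight m p τ N j) * ∑' l, x l * y (j - l)) ^ 2 ≤
      ENNReal.ofReal (algebraConst n p) ^ 2 *
        ((∑' l, (ENNReal.ofReal (gevreyWeight m p τ N l) * x l) ^ 2) *
          ∑' l, (ENNReal.ofReal (gevreyWeight m p τ N l) * y l) ^ 2) := by
  have hS := summable_bracket_rpow_neg hpn
  have hr0 (j : Fin n → ℤ) : 0 ≤ bracket j ^ (-p) := Real.rpow_nonneg (bracket_pos j).le _
  refine (tsum_convolution_sq_le _ (fun j => ENNReal.ofReal (bracket j ^ (-p)))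
    (ENNReal.ofReal (2 ^ (2 * p - 1))) (fun j l => ?_) x y).trans ?_
  · have h := gevreyWeight_add_sq_le m hp hτ hN j l
    have hw (k : Fin n → ℤ) := (gevreyWeight_pos m p τ N k).le
    have h2 : (0 : ℝ) ≤ 2 ^ (2 * p - 1) := by positivity
    rw [← ENNReal.ofReal_pow (hw _), ← ENNReal.ofReal_pow (hw _), ← ENNReal.ofReal_pow (hw _),
      ← ENNReal.ofReal_add (hr0 _) (hr0 _), ← ENNReal.ofReal_mul h2,
      ← ENNReal.ofReal_mul (sq_nonneg _),
      ← ENNReal.ofReal_mul (mul_nonneg h2 (add_nonneg (hr0 _) (hr0 _)))]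
    exact ENNReal.ofReal_le_ofReal h
  · refine mul_le_mul_left ?_ _
    have hT : 0 ≤ ∑' j : Fin n → ℤ, bracket j ^ (-p) := tsum_nonneg hr0
    rw [← ENNReal.ofReal_tsum_of_nonneg hr0 hS, algebraConst, ← ENNReal.ofReal_pow (by positivity),
      show (2 : ℝ≥0∞) = ENNReal.ofReal 2 by simp, ← ENNReal.ofReal_mul (by norm_num),
      ← ENNReal.ofReal_mul (by positivity)]
    refine ENNReal.ofReal_le_ofReal ?_
    rw [mul_pow, Real.sq_sqrt (by positivity), ← Real.rpow_natCast, ← Real.rpow_mul (by norm_num)]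
    gcongr
    · norm_num
    · push_cast; linarith

/-! ### Fourier coefficients of products and of the nonlinearity -/

open UnitAddTorus

lemma mFourierCoeff_eq_integral_torusMeasure {n : ℕ} (f : UnitAddTorus (Fin n) → ℂ)
    (j : Fin n → ℤ) : mFourierCoeff f j = ∫ x, mFourier (-j) x * f x ∂torusMeasure n := rfl

lemma integrable_continuousMap {n : ℕ} (f : C(UnitAddTorus (Fin n), ℂ)) :
    Integrable f (torusMeasure n) :=
  f.continuous.integrable_of_hasCompactSupport (HasCompactSupport.of_compactSpace _)

lemma norm_mFourierCoeff_le {n : ℕ} (f : C(UnitAddTorus (Fin n), ℂ)) (j : Fin n → ℤ) :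
    ‖mFourierCoeff f j‖ ≤ ‖f‖ := by
  rw [mFourierCoeff_eq_integral_torusMeasure]
  refine (norm_integral_le_of_norm_le_const (C := ‖f‖) (.of_forall fun x => ?_)).trans ?_
  · rw [norm_mul]
    calc _ ≤ ‖(mFourier (-j) : C(UnitAddTorus (Fin n), ℂ))‖ * ‖f‖ :=
          mul_le_mul (ContinuousMap.norm_coe_le_norm _ _) (ContinuousMap.norm_coe_le_norm _ _)
            (norm_nonneg _) (norm_nonneg _)
      _ = ‖f‖ := by rw [mFourier_norm, one_mul]
  · simp

lemma hasSum_mFourierCoeff {n : ℕ} {ι : Type*} [Countable ι] (F : ι → C(UnitAddTorus (Fin n), ℂ))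
    (hF : Summable fun i => ‖F i‖) (j : Fin n → ℤ) :
    HasSum (fun i => mFourierCoeff (F i) j) (mFourierCoeff (fun x => ∑' i, F i x) j) := by
  simp only [mFourierCoeff_eq_integral_torusMeasure, ← tsum_mul_left]
  refine hasSum_integral_of_summable_integral_norm
    (F := fun i x => mFourier (-j) x * F i x) (fun i => ?_) ?_
  · exact integrable_continuousMap (mFourier (-j) * F i)
  · refine Summable.of_nonneg_of_le (fun i => integral_nonneg fun _ => norm_nonneg _)
      (fun i => ?_) hF
    calc ∫ x, ‖mFourier (-j) x * F i x‖ ∂torusMeasure n ≤ ∫ _, ‖F i‖ ∂torusMeasure n := by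
          refine integral_mono (integrable_continuousMap (mFourier (-j) * F i)).norm
            (integrable_const _) fun x => ?_
          have := ContinuousMap.norm_coe_le_norm (mFourier (-j) * F i) x
          refine this.trans ((norm_mul_le _ _).trans ?_)
          rw [mFourier_norm, one_mul]
      _ = ‖F i‖ := by simp

lemma mFourierCoeff_mFourier {n : ℕ} (i j : Fin n → ℤ) :
    mFourierCoeff (mFourier i : C(UnitAddTorus (Fin n), ℂ)) j = if i = j then 1 else 0 := by
  have h : mFourierBasis.repr (mFourierBasis i) j =
      mFourierCoeff (mFourier i : C(UnitAddTorus (Fin n), ℂ)) j := by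
    rw [mFourierBasis_repr, coe_mFourierBasis]
    exact mFourierCoeff_toLp _ _
  rw [← h, HilbertBasis.repr_self, lp.single_apply]
  simp [Pi.single_apply, eq_comm]

lemma mFourierCoeff_smul_mul_mFourier {n : ℕ} (c : ℂ) (w : C(UnitAddTorus (Fin n), ℂ))
    (l j : Fin n → ℤ) :
    mFourierCoeff (c • (w * mFourier l) : C(UnitAddTorus (Fin n), ℂ)) j =
      c * mFourierCoeff w (j - l) := by
  simp only [mFourierCoeff_eq_integral_torusMeasure, ← integral_const_mul]
  refine integral_congr_ae (.of_forall fun x => ?_)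
  simp only [ContinuousMap.smul_apply, ContinuousMap.mul_apply, smul_eq_mul]
  rw [show -(j - l) = -j + l by abel, mFourier_add]
  ring

/-- An element of `L²` with summable Fourier coefficients has a continuous representative, the sum
of its Fourier series. -/
lemma exists_continuous_rep {n : ℕ} (v : L2Torus n) (hv : Summable (coeff v)) :
    ∃ V : C(UnitAddTorus (Fin n), ℂ), v =ᵐ[torusMeasure n] V ∧
      ∀ x, HasSum (fun j => coeff v j * mFourier j x) (V x) := by
  have hs : Summable fun j => coeff v j • (mFourier j : C(UnitAddTorus (Fin n), ℂ)) := by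
    refine Summable.of_norm ?_
    simpa only [norm_smul, mFourier_norm, mul_one] using hv.norm
  obtain ⟨V, hV⟩ := hs
  refine ⟨V, ?_, fun x => by simpa using! (ContinuousMap.evalCLM ℂ x).hasSum hV⟩
  have h1 := (ContinuousMap.toLp (E := ℂ) 2 (torusMeasure n) ℂ).hasSum hV
  have h2 := hasSum_mFourier_series_L2 v
  have h3 : v = ContinuousMap.toLp (E := ℂ) 2 (torusMeasure n) ℂ V := by
    refine h2.unique ?_
    simpa using! h1
  rw [h3]
  exact ContinuousMap.coeFn_toLp (torusMeasure n) V

/-- The Fourier coefficients of a product are a convolution. -/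
lemma hasSum_mFourierCoeff_mul {n : ℕ} {c : (Fin n → ℤ) → ℂ} (hc : Summable c)
    {V : C(UnitAddTorus (Fin n), ℂ)} (hV : ∀ x, HasSum (fun j => c j * mFourier j x) (V x))
    (w : C(UnitAddTorus (Fin n), ℂ)) (j : Fin n → ℤ) :
    HasSum (fun l => c l * mFourierCoeff w (j - l)) (mFourierCoeff (w * V) j) := by
  have h := hasSum_mFourierCoeff
    (fun l => c l • (w * mFourier l : C(UnitAddTorus (Fin n), ℂ))) ?_ j
  · simp only [mFourierCoeff_smul_mul_mFourier] at h
    convert h using 2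
    funext x
    rw [ContinuousMap.mul_apply, ← (hV x).tsum_eq, ← tsum_mul_left]
    refine tsum_congr fun l => ?_
    simp only [ContinuousMap.smul_apply, ContinuousMap.mul_apply, smul_eq_mul]
    ring
  · refine Summable.of_nonneg_of_le (fun _ => norm_nonneg _) (fun l => ?_) (hc.norm.mul_right ‖w‖)
    rw [norm_smul]
    refine mul_le_mul_of_nonneg_left ((norm_mul_le _ _).trans ?_) (norm_nonneg _)
    rw [mFourier_norm, mul_one]

/-- Powers of `V`, shifted in frequency: `‖V^k e_i‖ ≤ ‖e_i‖ (C₀ ‖V‖)^k` in the norm of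
`𝒟(A^p e^{τ𝒜})`. -/
lemma weightedNormSq_pow_mul_mFourier_le {n : ℕ} (m : ℕ) {p τ N : ℝ} (hpn : (n : ℝ) / 2 < p)
    (hp : 1 ≤ p) (hτ : 0 ≤ τ) (hN : 0 ≤ N) {c : (Fin n → ℤ) → ℂ} (hc : Summable c)
    {V : C(UnitAddTorus (Fin n), ℂ)} (hV : ∀ x, HasSum (fun j => c j * mFourier j x) (V x))
    (k : ℕ) (i : Fin n → ℤ) :
    weightedNormSq (gevreyWeight m p τ N)
        (mFourierCoeff (mFourier i * V ^ k : C(UnitAddTorus (Fin n), ℂ))) ≤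
      ENNReal.ofReal (gevreyWeight m p τ N i) ^ 2 *
        (ENNReal.ofReal (algebraConst n p) ^ 2 *
          weightedNormSq (gevreyWeight m p τ N) c) ^ k := by
  induction k with
  | zero =>
    simp only [pow_zero, mul_one, weightedNormSq]
    rw [tsum_eq_single i]
    · simp [mFourierCoeff_mFourier]
    · intro j hj
      simp [mFourierCoeff_mFourier, hj.symm]
  | succ k ih =>
    set w := gevreyWeight m p τ N with hw
    set y := mFourierCoeff (mFourier i * V ^ k : C(UnitAddTorus (Fin n), ℂ)) with hy
    have e : (mFourier i * V ^ (k + 1) : C(UnitAddTorus (Fin n), ℂ)) =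
        (mFourier i * V ^ k) * V := by ring
    have hbound (j : Fin n → ℤ) : ‖mFourierCoeff
        (mFourier i * V ^ (k + 1) : C(UnitAddTorus (Fin n), ℂ)) j‖ₑ ≤
          ∑' l, ‖c l‖ₑ * ‖y (j - l)‖ₑ := by
      rw [e, ← (hasSum_mFourierCoeff_mul hc hV (mFourier i * V ^ k) j).tsum_eq]
      simp only [← enorm_mul]
      exact enorm_tsum_le_tsum_enorm
    calc weightedNormSq w (mFourierCoeff
          (mFourier i * V ^ (k + 1) : C(UnitAddTorus (Fin n), ℂ)))
        ≤ ∑' j, (ENNReal.ofReal (w j) * ∑' l, ‖c l‖ₑ * ‖y (j - l)‖ₑ) ^ 2 :=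
          ENNReal.tsum_le_tsum fun j => pow_le_pow_left' (mul_le_mul_right (hbound j) _) 2
      _ ≤ ENNReal.ofReal (algebraConst n p) ^ 2 * (weightedNormSq w c * weightedNormSq w y) :=
          tsum_gevreyWeight_convolution_sq_le m hpn hp hτ hN _ _
      _ ≤ ENNReal.ofReal (algebraConst n p) ^ 2 * (weightedNormSq w c *
          (ENNReal.ofReal (w i) ^ 2 * (ENNReal.ofReal (algebraConst n p) ^ 2 *
            weightedNormSq w c) ^ k)) := by gcongr
      _ = _ := by ring

lemma summable_of_memSobolev {n : ℕ} {p : ℝ} (hpn : (n : ℝ) / 2 < p) {c : (Fin n → ℤ) → ℂ}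
    (hc : MemSobolev p c) : Summable c := by
  refine Summable.of_norm_bounded (hc.add (summable_bracket_rpow_neg hpn)) fun j => ?_
  rw [Real.rpow_neg (bracket_pos j).le, ← bracket_rpow_half_sq]
  have hx : 0 < bracket j ^ (p / 2) := Real.rpow_pos_of_pos (bracket_pos j) _
  have h := two_mul_le_add_sq (‖c j‖ * bracket j ^ (p / 2)) (bracket j ^ (p / 2))⁻¹
  have e : 2 * (‖c j‖ * bracket j ^ (p / 2)) * (bracket j ^ (p / 2))⁻¹ = 2 * ‖c j‖ := by
    field_simp
  rw [e, mul_pow, inv_pow] at h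
  linarith [norm_nonneg (c j)]

lemma algebraConst_nonneg (n : ℕ) (p : ℝ) : 0 ≤ algebraConst n p := by
  unfold algebraConst; positivity

lemma majorantTerm_nonneg {n : ℕ} (m : ℕ) (p lam : ℝ) (a : (Fin n → ℤ) → ℕ → ℝ → ℂ) (t : ℝ)
    {s : ℝ} (hs : 0 ≤ s) (q : ℕ × (Fin n → ℤ)) : 0 ≤ majorantTerm m p lam a t s q := by
  have := Real.rpow_nonneg (bracket_pos q.2).le (p / 2)
  unfold majorantTerm
  positivity

lemma norm_mul_pow_le_majorantTerm {n : ℕ} (m : ℕ) {p lam : ℝ} (hp : 0 ≤ p) (hlam : 0 ≤ lam)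
    (a : (Fin n → ℤ) → ℕ → ℝ → ℂ) (t : ℝ) {s : ℝ} (hs : 0 ≤ s) (q : ℕ × (Fin n → ℤ)) :
    ‖a q.2 q.1 t‖ * s ^ q.1 ≤ majorantTerm m p lam a t s q := by
  have h1 : 1 ≤ bracket q.2 ^ (p / 2) := Real.one_le_rpow (one_le_bracket _) (by positivity)
  have h2 : 1 ≤ Real.exp (lam * absFirst m q.2) :=
    Real.one_le_exp (mul_nonneg hlam (absFirst_nonneg _ _))
  unfold majorantTerm
  gcongr
  rw [mul_assoc]
  exact le_mul_of_one_le_right (norm_nonneg _) (one_le_mul_of_one_le_of_one_le h1 h2)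

/-- The expansion of the Fourier coefficients of `f(t, x, V(x))` along the power series of `f`. -/
lemma hasSum_mFourierCoeff_nonlinearity {n : ℕ} (m : ℕ) {p lam : ℝ} (hp : 0 ≤ p) (hlam : 0 ≤ lam)
    {a : (Fin n → ℤ) → ℕ → ℝ → ℂ} {t : ℝ} (hs : ∀ s : ℝ, Summable (majorantTerm m p lam a t s))
    (V : C(UnitAddTorus (Fin n), ℂ)) (j : Fin n → ℤ) :
    HasSum (fun q : ℕ × (Fin n → ℤ) => a q.2 q.1 t *
        mFourierCoeff (mFourier q.2 * V ^ q.1 : C(UnitAddTorus (Fin n), ℂ)) j)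
      (mFourierCoeff (fun x => nonlinearity a t x (V x)) j) := by
  have hsum : Summable fun q : ℕ × (Fin n → ℤ) =>
      ‖a q.2 q.1 t • (mFourier q.2 * V ^ q.1 : C(UnitAddTorus (Fin n), ℂ))‖ := by
    refine Summable.of_nonneg_of_le (fun _ => norm_nonneg _) (fun q => ?_) (hs ‖V‖)
    refine le_trans ?_ (norm_mul_pow_le_majorantTerm m hp hlam a t (norm_nonneg V) q)
    rw [norm_smul]
    gcongr
    refine (norm_mul_le _ _).trans ?_
    rw [mFourier_norm, one_mul]
    exact norm_pow_le _ _
  have h := hasSum_mFourierCoeff _ hsum j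
  have e1 (q : ℕ × (Fin n → ℤ)) : mFourierCoeff
      (a q.2 q.1 t • (mFourier q.2 * V ^ q.1) : C(UnitAddTorus (Fin n), ℂ)) j =
      a q.2 q.1 t * mFourierCoeff (mFourier q.2 * V ^ q.1 : C(UnitAddTorus (Fin n), ℂ)) j := by
    simp only [mFourierCoeff_eq_integral_torusMeasure, ← integral_const_mul]
    refine integral_congr_ae (.of_forall fun x => ?_)
    simp only [ContinuousMap.smul_apply, smul_eq_mul]
    ring
  simp only [e1] at h
  convert h using 2
  funext x
  have hx : Summable fun q : (Fin n → ℤ) × ℕ =>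
      (a q.1 q.2 t • (mFourier q.1 * V ^ q.2 : C(UnitAddTorus (Fin n), ℂ))) x := by
    have h1 : Summable fun q : ℕ × (Fin n → ℤ) =>
      (a q.2 q.1 t • (mFourier q.2 * V ^ q.1 : C(UnitAddTorus (Fin n), ℂ))) x :=
      Summable.of_norm_bounded hsum fun q => ContinuousMap.norm_coe_le_norm _ x
    exact h1.prod_symm
  rw [← (Equiv.prodComm (Fin n → ℤ) ℕ).tsum_eq, nonlinearity]
  simp only [Equiv.prodComm_apply, Prod.fst_swap, Prod.snd_swap]
  rw [hx.tsum_prod]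
  refine tsum_congr fun i => ?_
  rw [← tsum_mul_right]
  refine tsum_congr fun k => ?_
  simp only [ContinuousMap.smul_apply, ContinuousMap.mul_apply, ContinuousMap.pow_apply,
    smul_eq_mul]
  ring

/-- The estimate `‖f(t, ·, V)‖ ≤ g(t, C₀ ‖V‖)` in the (truncated) norm of `𝒟(A^p e^{τ𝒜})`, tested
against a finite family of coefficients `b`. -/
lemma sum_norm_mFourierCoeff_nonlinearity_le {n : ℕ} (m : ℕ) {p lam τ N B : ℝ}
    (hpn : (n : ℝ) / 2 < p) (hp : 1 ≤ p) (hτ : 0 ≤ τ) (hτl : τ ≤ lam) (hN : 0 ≤ N) (hB : 0 ≤ B)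
    {a : (Fin n → ℤ) → ℕ → ℝ → ℂ} {t : ℝ} (hs : ∀ s : ℝ, Summable (majorantTerm m p lam a t s))
    {c : (Fin n → ℤ) → ℂ} (hc : Summable c)
    {V : C(UnitAddTorus (Fin n), ℂ)} (hV : ∀ x, HasSum (fun j => c j * mFourier j x) (V x))
    (hcB : weightedNormSq (gevreyWeight m p τ N) c ≤ ENNReal.ofReal (B ^ 2))
    (S : Finset (Fin n → ℤ)) (b : (Fin n → ℤ) → ℝ) (hb : ∀ j, 0 ≤ b j) :
    ∑ j ∈ S, gevreyWeight m p τ N j ^ 2 *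
        (‖mFourierCoeff (fun x => nonlinearity a t x (V x)) j‖ * b j) ≤
      majorant m p lam a t (algebraConst n p * B) *
        √(∑ j ∈ S, gevreyWeight m p τ N j ^ 2 * b j ^ 2) := by
  have hC := algebraConst_nonneg n p
  have hlam : 0 ≤ lam := hτ.trans hτl
  have hw (j : Fin n → ℤ) := gevreyWeight_pos m p τ N j
  set w := gevreyWeight m p τ N with hwdef
  set y : ℕ × (Fin n → ℤ) → (Fin n → ℤ) → ℂ := fun q =>
    mFourierCoeff (mFourier q.2 * V ^ q.1 : C(UnitAddTorus (Fin n), ℂ)) with hy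
  have hysum (j : Fin n → ℤ) : Summable fun q => ‖a q.2 q.1 t‖ * ‖y q j‖ := by
    refine Summable.of_nonneg_of_le (fun _ => by positivity) (fun q => ?_) (hs ‖V‖)
    refine le_trans ?_ (norm_mul_pow_le_majorantTerm m (by linarith) hlam a t (norm_nonneg V) q)
    gcongr
    refine (norm_mFourierCoeff_le _ _).trans ((norm_mul_le _ _).trans ?_)
    rw [mFourier_norm, one_mul]
    exact norm_pow_le _ _
  have hF (j : Fin n → ℤ) : ‖mFourierCoeff (fun x => nonlinearity a t x (V x)) j‖ ≤
      ∑' q, ‖a q.2 q.1 t‖ * ‖y q j‖ := by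
    rw [← (hasSum_mFourierCoeff_nonlinearity m (by linarith) hlam hs V j).tsum_eq]
    simp only [← norm_mul]
    exact norm_tsum_le_tsum_norm (by simpa only [norm_mul] using hysum j)
  have hynorm (q : ℕ × (Fin n → ℤ)) :
      √(∑ j ∈ S, (w j * ‖y q j‖) ^ 2) ≤ w q.2 * (algebraConst n p * B) ^ q.1 := by
    refine Real.sqrt_le_iff.2 ⟨by have := hw q.2; positivity, ?_⟩
    rw [← ENNReal.ofReal_le_ofReal_iff (by positivity),
      ENNReal.ofReal_sum_of_nonneg fun _ _ => sq_nonneg _]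
    calc ∑ j ∈ S, ENNReal.ofReal ((w j * ‖y q j‖) ^ 2)
        = ∑ j ∈ S, (ENNReal.ofReal (w j) * ‖y q j‖ₑ) ^ 2 := by
          refine Finset.sum_congr rfl fun j _ => ?_
          rw [ENNReal.ofReal_pow (mul_nonneg (hw j).le (norm_nonneg _)),
            ENNReal.ofReal_mul (hw j).le, ofReal_norm]
      _ ≤ weightedNormSq w (y q) := ENNReal.sum_le_tsum S
      _ ≤ _ := weightedNormSq_pow_mul_mFourier_le m hpn hp hτ hN hc hV q.1 q.2
      _ ≤ ENNReal.ofReal (w q.2) ^ 2 * (ENNReal.ofReal (algebraConst n p) ^ 2 *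
            ENNReal.ofReal (B ^ 2)) ^ q.1 := by gcongr
      _ = _ := by
          rw [← ENNReal.ofReal_pow (hw _).le, ← ENNReal.ofReal_pow hC,
            ← ENNReal.ofReal_mul (by positivity), ← ENNReal.ofReal_pow (by positivity),
            ← ENNReal.ofReal_mul (by positivity)]
          congr 1; ring
  calc ∑ j ∈ S, w j ^ 2 * (‖mFourierCoeff (fun x => nonlinearity a t x (V x)) j‖ * b j)
      ≤ ∑ j ∈ S, w j ^ 2 * ((∑' q, ‖a q.2 q.1 t‖ * ‖y q j‖) * b j) := by
        gcongr with j
        · exact hb j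
        · exact hF j
    _ = ∑ j ∈ S, ∑' q, ‖a q.2 q.1 t‖ * ((w j * ‖y q j‖) * (w j * b j)) := by
        refine Finset.sum_congr rfl fun j _ => ?_
        rw [← tsum_mul_right, ← tsum_mul_left]
        exact tsum_congr fun q => by ring
    _ = ∑' q, ∑ j ∈ S, ‖a q.2 q.1 t‖ * ((w j * ‖y q j‖) * (w j * b j)) := by
        refine (Summable.tsum_finsetSum fun j _ => ?_).symm
        refine ((hysum j).mul_left (w j * (w j * b j))).congr fun q => by ring
    _ ≤ ∑' q, majorantTerm m p lam a t (algebraConst n p * B) q *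
          √(∑ j ∈ S, w j ^ 2 * b j ^ 2) := by
        refine Summable.tsum_le_tsum (fun q => ?_) ?_ ((hs _).mul_right _)
        · rw [← Finset.mul_sum]
          calc ‖a q.2 q.1 t‖ * ∑ j ∈ S, (w j * ‖y q j‖) * (w j * b j)
              ≤ ‖a q.2 q.1 t‖ * (√(∑ j ∈ S, (w j * ‖y q j‖) ^ 2) *
                  √(∑ j ∈ S, (w j * b j) ^ 2)) := by
                gcongr; exact Real.sum_mul_le_sqrt_mul_sqrt _ _ _
            _ ≤ ‖a q.2 q.1 t‖ * ((bracket q.2 ^ (p / 2) * Real.exp (lam * absFirst m q.2) *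
                  (algebraConst n p * B) ^ q.1) * √(∑ j ∈ S, (w j * b j) ^ 2)) := by
                gcongr
                refine (hynorm q).trans ?_
                have hbr := Real.rpow_nonneg (bracket_pos q.2).le (p / 2)
                rw [hwdef, gevreyWeight]
                gcongr
                · exact cutoff_nonneg m hN _
                · exact min_le_left _ _
            _ = _ := by simp only [mul_pow, majorantTerm]; ring
        · exact summable_sum fun j _ =>
            ((hysum j).mul_left (w j * (w j * b j))).congr fun q => by ring
    _ = _ := by rw [tsum_mul_right, majorant]

/-- Testing the equation against a character gives the equation of each Fourier coefficient. -/
lemma WeakEquation.coeff_eq {n : ℕ} {a : (Fin n → ℤ) → ℕ → ℝ → ℂ} {t : ℝ} {v : L2Torus n}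
    {w : (Fin n → ℤ) → ℂ} (h : WeakEquation a t v w) {V : C(UnitAddTorus (Fin n), ℂ)}
    (hV : v =ᵐ[torusMeasure n] V) (j : Fin n → ℤ) :
    w j + bracket j * coeff v j + mFourierCoeff (fun x => nonlinearity a t x (V x)) j = 0 := by
  let φ : L2Torus n := ContinuousMap.toLp (E := ℂ) 2 (torusMeasure n) ℂ (mFourier j)
  have hφ : coeff φ = fun l => if l = j then 1 else 0 := by
    funext l
    have h1 : coeff φ l = mFourierCoeff (mFourier j : C(UnitAddTorus (Fin n), ℂ)) l :=
      mFourierCoeff_toLp _ l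
    rw [h1, mFourierCoeff_mFourier]
    simp only [eq_comm]
  have hmem : MemSobolev 1 (coeff φ) := by
    refine summable_of_ne_finset_zero (s := {j}) fun l hl => ?_
    simp [hφ, Finset.notMem_singleton.1 hl]
  have key := h φ hmem
  simp only [hφ] at key
  rw [tsum_eq_single j (by intro l hl; simp [hl]), tsum_eq_single j (by intro l hl; simp [hl])]
    at key
  simp only [if_true, star_one, mul_one] at key
  rw [← key, mFourierCoeff_eq_integral_torusMeasure]
  congr 1
  refine integral_congr_ae ?_
  have hφe : φ =ᵐ[torusMeasure n] (mFourier j : C(UnitAddTorus (Fin n), ℂ)) :=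
    ContinuousMap.coeFn_toLp (torusMeasure n) _
  filter_upwards [hV, hφe] with x h1 h2
  rw [h1, h2, mFourier_neg, mul_comm]
  rfl

/-! ### Curves in Sobolev spaces -/

lemma sobolev_term_nonneg {n : ℕ} (s : ℝ) (c : (Fin n → ℤ) → ℂ) (j : Fin n → ℤ) :
    0 ≤ ‖c j‖ ^ 2 * bracket j ^ s :=
  mul_nonneg (sq_nonneg _) (Real.rpow_nonneg (bracket_pos j).le _)

lemma sobolevNorm_nonneg {n : ℕ} (s : ℝ) (c : (Fin n → ℤ) → ℂ) : 0 ≤ sobolevNorm s c :=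
  Real.sqrt_nonneg _

lemma sobolevNorm_sq {n : ℕ} (s : ℝ) (c : (Fin n → ℤ) → ℂ) :
    sobolevNorm s c ^ 2 = ∑' j, ‖c j‖ ^ 2 * bracket j ^ s :=
  Real.sq_sqrt (tsum_nonneg (sobolev_term_nonneg s c))

lemma MemSobolev.mono {n : ℕ} {s r : ℝ} (hrs : r ≤ s) {c : (Fin n → ℤ) → ℂ}
    (hc : MemSobolev s c) : MemSobolev r c :=
  Summable.of_nonneg_of_le (sobolev_term_nonneg r c) (fun j => mul_le_mul_of_nonneg_left
    (Real.rpow_le_rpow_of_exponent_le (one_le_bracket j) hrs) (sq_nonneg _)) hc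

lemma norm_sub_sq_le {E : Type*} [SeminormedAddCommGroup E] (x y : E) :
    ‖x - y‖ ^ 2 ≤ 2 * ‖x‖ ^ 2 + 2 * ‖y‖ ^ 2 := by
  have h := norm_sub_le x y
  nlinarith [sq_nonneg (‖x‖ - ‖y‖), norm_nonneg (x - y), norm_nonneg x, norm_nonneg y]

lemma MemSobolev.sub {n : ℕ} {s : ℝ} {c d : (Fin n → ℤ) → ℂ} (hc : MemSobolev s c)
    (hd : MemSobolev s d) : MemSobolev s (c - d) := by
  refine Summable.of_nonneg_of_le (sobolev_term_nonneg s _) (fun j => ?_)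
    ((hc.mul_left 2).add (hd.mul_left 2))
  have := mul_le_mul_of_nonneg_right (norm_sub_sq_le (c j) (d j))
    (Real.rpow_nonneg (bracket_pos j).le s)
  simp only [Pi.sub_apply]
  linarith

lemma MemSobolev.smul {n : ℕ} {s : ℝ} (r : ℝ) {c : (Fin n → ℤ) → ℂ} (hc : MemSobolev s c) :
    MemSobolev s (r • c) := by
  refine (hc.mul_left (r ^ 2)).congr fun j => ?_
  rw [Pi.smul_apply, norm_smul, mul_pow, Real.norm_eq_abs, sq_abs]
  ring

lemma sobolevNorm_le_add_sub {n : ℕ} {s : ℝ} {c d : (Fin n → ℤ) → ℂ} (hc : MemSobolev s c)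
    (hd : MemSobolev s d) : sobolevNorm s c ≤ sobolevNorm s d + sobolevNorm s (c - d) := by
  have e (x : (Fin n → ℤ) → ℂ) (j : Fin n → ℤ) :
      (‖x j‖ * bracket j ^ (s / 2)) ^ (2 : ℝ) = ‖x j‖ ^ 2 * bracket j ^ s := by
    rw [Real.rpow_two, mul_pow, bracket_rpow_half_sq]
  have h0 (x : (Fin n → ℤ) → ℂ) (j : Fin n → ℤ) : 0 ≤ ‖x j‖ * bracket j ^ (s / 2) :=
    mul_nonneg (norm_nonneg _) (Real.rpow_nonneg (bracket_pos j).le _)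
  obtain ⟨h1, h2⟩ := Real.Lp_add_le_tsum_of_nonneg (p := 2) one_le_two (h0 d) (h0 (c - d))
    (by simpa only [e] using! hd) (by simpa only [e] using! hc.sub hd)
  simp only [e, ← Real.sqrt_eq_rpow] at h2
  refine le_trans (Real.sqrt_le_sqrt (Summable.tsum_le_tsum (fun j => ?_) hc h1)) h2
  rw [← e]
  refine Real.rpow_le_rpow (h0 c j) ?_ (by norm_num)
  rw [← add_mul]
  refine mul_le_mul_of_nonneg_right ?_ (Real.rpow_nonneg (bracket_pos j).le _)
  simpa using norm_add_le (d j) ((c - d) j)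

lemma ContinuousInSobolev.continuousOn_sobolevNorm {n : ℕ} {T s : ℝ}
    {c : ℝ → (Fin n → ℤ) → ℂ} (hc : ContinuousInSobolev T s c) :
    ContinuousOn (fun t => sobolevNorm s (c t)) (Icc 0 T) := by
  intro t ht
  rw [ContinuousWithinAt, tendsto_iff_norm_sub_tendsto_zero]
  refine squeeze_zero' (.of_forall fun _ => norm_nonneg _) ?_ (hc.2 t ht)
  filter_upwards [self_mem_nhdsWithin] with r hr
  rw [Real.norm_eq_abs, abs_sub_le_iff]
  have e : sobolevNorm s (c t - c r) = sobolevNorm s (c r - c t) := by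
    simp only [sobolevNorm, Pi.sub_apply, norm_sub_rev]
  have h1 := sobolevNorm_le_add_sub (hc.1 r hr) (hc.1 t ht)
  have h2 := sobolevNorm_le_add_sub (hc.1 t ht) (hc.1 r hr)
  constructor <;> linarith

/-- The values of a continuous curve in `H^s` on a compact interval have uniformly small tails. -/
lemma ContinuousInSobolev.exists_tail_le {n : ℕ} {T s : ℝ} {c : ℝ → (Fin n → ℤ) → ℂ}
    (hc : ContinuousInSobolev T s c) {ε : ℝ} (hε : 0 < ε) :
    ∃ S₀ : Finset (Fin n → ℤ), ∀ S, S₀ ⊆ S → ∀ t ∈ Icc 0 T,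
      ∑' j : ↥((S : Set (Fin n → ℤ))ᶜ), ‖c t j‖ ^ 2 * bracket (j : Fin n → ℤ) ^ s ≤ ε := by
  refine isCompact_Icc.induction_on (p := fun I => ∃ S₀ : Finset (Fin n → ℤ), ∀ S, S₀ ⊆ S →
    ∀ t ∈ I, ∑' j : ↥((S : Set (Fin n → ℤ))ᶜ), ‖c t j‖ ^ 2 * bracket (j : Fin n → ℤ) ^ s ≤ ε)
    ⟨∅, by simp⟩ ?_ ?_ ?_
  · rintro I J hIJ ⟨S₀, h⟩
    exact ⟨S₀, fun S hS t ht => h S hS t (hIJ ht)⟩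
  · classical
    rintro I J ⟨S₁, h₁⟩ ⟨S₂, h₂⟩
    refine ⟨S₁ ∪ S₂, fun S hS t ht => ?_⟩
    rcases ht with ht | ht
    · exact h₁ S (Finset.union_subset_left hS) t ht
    · exact h₂ S (Finset.union_subset_right hS) t ht
  · intro t ht
    have hsum := hc.1 t ht
    obtain ⟨S₀, hS₀⟩ : ∃ S₀ : Finset (Fin n → ℤ), ∀ S, S₀ ⊆ S →
        ∑' j : ↥((S : Set (Fin n → ℤ))ᶜ), ‖c t j‖ ^ 2 * bracket (j : Fin n → ℤ) ^ s ≤ ε / 4 := by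
      have h := (tendsto_tsum_compl_atTop_zero
        fun j => ‖c t j‖ ^ 2 * bracket j ^ s).eventually (gt_mem_nhds (show (0 : ℝ) < ε / 4 by
          positivity))
      obtain ⟨S₀, h⟩ := eventually_atTop.1 h
      exact ⟨S₀, fun S hS => (h S hS).le⟩
    have hnear : ∀ᶠ r in 𝓝[Icc 0 T] t, sobolevNorm s (c r - c t) ^ 2 < ε / 4 := by
      have h := (hc.2 t ht).pow 2
      rw [zero_pow two_ne_zero] at h
      exact h.eventually (gt_mem_nhds (by positivity))
    refine ⟨{r | r ∈ Icc 0 T ∧ sobolevNorm s (c r - c t) ^ 2 < ε / 4},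
      (eventually_mem_nhdsWithin.and hnear), S₀, fun S hS r hr => ?_⟩
    have hdiff := (hc.1 r hr.1).sub hsum
    have h1 : ∑' j : ↥((S : Set (Fin n → ℤ))ᶜ),
        ‖(c r - c t) j‖ ^ 2 * bracket (j : Fin n → ℤ) ^ s ≤ ε / 4 := by
      refine le_trans ?_ hr.2.le
      rw [sobolevNorm_sq]
      exact Summable.tsum_subtype_le _ _ (sobolev_term_nonneg s _) hdiff
    have s1 := hsum.subtype ((S : Set (Fin n → ℤ))ᶜ)
    have s2 := hdiff.subtype ((S : Set (Fin n → ℤ))ᶜ)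
    have s3 := (hc.1 r hr.1).subtype ((S : Set (Fin n → ℤ))ᶜ)
    calc _ ≤ ∑' j : ↥((S : Set (Fin n → ℤ))ᶜ),
          (2 * (‖(c r - c t) j‖ ^ 2 * bracket (j : Fin n → ℤ) ^ s) +
            2 * (‖c t j‖ ^ 2 * bracket (j : Fin n → ℤ) ^ s)) := by
          refine Summable.tsum_le_tsum (fun j => ?_) s3 ((s2.mul_left 2).add (s1.mul_left 2))
          have h := norm_sub_sq_le ((c r - c t) j) (-(c t j))
          rw [Pi.sub_apply, sub_neg_eq_add, sub_add_cancel, norm_neg] at h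
          have := mul_le_mul_of_nonneg_right h
            (Real.rpow_nonneg (bracket_pos (j : Fin n → ℤ)).le s)
          rw [Pi.sub_apply]
          linarith
      _ = 2 * ∑' j : ↥((S : Set (Fin n → ℤ))ᶜ),
            (‖(c r - c t) j‖ ^ 2 * bracket (j : Fin n → ℤ) ^ s) +
          2 * ∑' j : ↥((S : Set (Fin n → ℤ))ᶜ),
            (‖c t j‖ ^ 2 * bracket (j : Fin n → ℤ) ^ s) := by
          rw [← tsum_mul_left, ← tsum_mul_left]
          exact Summable.tsum_add (s2.mul_left 2) (s1.mul_left 2)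
      _ ≤ ε := by linarith [hS₀ S hS]

/-- Differentiability in `H^s` implies that of each Fourier coefficient. -/
lemma HasTimeDeriv.hasDerivWithinAt_coeff {n : ℕ} {T s : ℝ} {c d : ℝ → (Fin n → ℤ) → ℂ}
    (h : HasTimeDeriv T s c d) (hc : ∀ t ∈ Icc 0 T, MemSobolev s (c t))
    (hd : ∀ t ∈ Icc 0 T, MemSobolev s (d t)) (j : Fin n → ℤ) {t : ℝ} (ht : t ∈ Icc 0 T) :
    HasDerivWithinAt (fun r => c r j) (d t j) (Icc 0 T) t := by
  rw [hasDerivWithinAt_iff_tendsto_slope, tendsto_iff_norm_sub_tendsto_zero]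
  have hb : 0 < bracket j ^ (s / 2) := Real.rpow_pos_of_pos (bracket_pos j) _
  have hlim := (h t ht).mul_const (bracket j ^ (s / 2))⁻¹
  rw [zero_mul] at hlim
  refine squeeze_zero' (.of_forall fun _ => norm_nonneg _) ?_ hlim
  filter_upwards [self_mem_nhdsWithin] with r hr
  rw [← div_eq_mul_inv, le_div_iff₀ hb]
  refine Real.le_sqrt_of_sq_le ?_
  have hmem := (((hc r hr.1).sub (hc t ht)).smul (r - t)⁻¹).sub (hd t ht)
  refine le_trans (le_of_eq ?_) (hmem.le_tsum j fun i _ => sobolev_term_nonneg s _ i)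
  rw [mul_pow, bracket_rpow_half_sq]
  rfl

/-! ### Continuity of the majorant -/

lemma majorant_nonneg {n : ℕ} (m : ℕ) (p lam : ℝ) (a : (Fin n → ℤ) → ℕ → ℝ → ℂ) (t : ℝ)
    {s : ℝ} (hs : 0 ≤ s) : 0 ≤ majorant m p lam a t s :=
  tsum_nonneg (majorantTerm_nonneg m p lam a t hs)

lemma majorantTerm_mono {n : ℕ} (m : ℕ) (p lam : ℝ) (a : (Fin n → ℤ) → ℕ → ℝ → ℂ) (t : ℝ)
    {r s : ℝ} (hr : 0 ≤ r) (hrs : r ≤ s) (q : ℕ × (Fin n → ℤ)) :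
    majorantTerm m p lam a t r q ≤ majorantTerm m p lam a t s q := by
  have := Real.rpow_nonneg (bracket_pos q.2).le (p / 2)
  unfold majorantTerm
  gcongr

section Majorant

variable {n m : ℕ} {p lam T : ℝ} {a : (Fin n → ℤ) → ℕ → ℝ → ℂ}

lemma MajorantAssumption.majorant_mono (ha : MajorantAssumption m p lam T a) {t r s : ℝ}
    (ht : t ∈ Icc 0 T) (hr : 0 ≤ r) (hrs : r ≤ s) :
    majorant m p lam a t r ≤ majorant m p lam a t s :=
  Summable.tsum_le_tsum (majorantTerm_mono m p lam a t hr hrs) (ha.summable t ht r)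
    (ha.summable t ht s)

lemma MajorantAssumption.continuousOn_majorant_right (ha : MajorantAssumption m p lam T a) {t : ℝ}
    (ht : t ∈ Icc 0 T) (R : ℝ) : ContinuousOn (majorant m p lam a t) (Icc 0 R) := by
  refine continuousOn_tsum (fun q => ?_) (ha.summable t ht R) fun q s hs => ?_
  · unfold majorantTerm
    fun_prop
  · rw [Real.norm_of_nonneg (majorantTerm_nonneg m p lam a t hs.1 q)]
    exact majorantTerm_mono m p lam a t hs.1 hs.2 q

/-- The majorant is continuous in time along any continuous nonnegative curve: it is continuous in
each variable and monotone in the second one. -/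
lemma MajorantAssumption.continuousOn_majorant_comp (ha : MajorantAssumption m p lam T a)
    {s : ℝ → ℝ} (hs : ContinuousOn s (Icc 0 T)) (hs0 : ∀ t ∈ Icc 0 T, 0 ≤ s t) :
    ContinuousOn (fun t => majorant m p lam a t (s t)) (Icc 0 T) := by
  intro t ht
  rw [ContinuousWithinAt, Metric.tendsto_nhds]
  intro ε hε
  have hR := ha.continuousOn_majorant_right ht (s t + 1)
  have hmem : s t ∈ Icc 0 (s t + 1) := ⟨hs0 t ht, by linarith⟩
  obtain ⟨δ, hδ, hδc⟩ := Metric.continuousWithinAt_iff.1 (hR _ hmem) (ε / 2) (by positivity)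
  set η := min (δ / 2) 1 with hη
  have hη0 : 0 < η := by positivity
  have hη1 : η < δ := (min_le_left _ _).trans_lt (by linarith)
  have hη2 : η ≤ 1 := min_le_right _ _
  have hlo0 : 0 ≤ max (s t - η) 0 := le_max_right _ _
  have hhi0 : 0 ≤ s t + η := by linarith [hs0 t ht]
  have hlo : dist (majorant m p lam a t (max (s t - η) 0)) (majorant m p lam a t (s t)) < ε / 2 := by
    refine hδc ⟨hlo0, max_le (by linarith) (by linarith [hs0 t ht])⟩ ?_
    rw [Real.dist_eq, abs_lt]
    constructor
    · linarith [le_max_left (s t - η) 0]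
    · have : max (s t - η) 0 ≤ s t := max_le (by linarith) (hs0 t ht)
      linarith
  have hhi : dist (majorant m p lam a t (s t + η)) (majorant m p lam a t (s t)) < ε / 2 := by
    refine hδc ⟨hhi0, by linarith⟩ ?_
    rw [Real.dist_eq, abs_lt]
    constructor <;> linarith
  have e1 := Metric.tendsto_nhds.1 (ha.continuousOn_majorant _ hlo0 t ht) (ε / 2) (by positivity)
  have e2 := Metric.tendsto_nhds.1 (ha.continuousOn_majorant _ hhi0 t ht) (ε / 2) (by positivity)
  have e3 := Metric.tendsto_nhds.1 (hs t ht) η hη0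
  filter_upwards [e1, e2, e3, self_mem_nhdsWithin] with r h1 h2 h3 hr
  rw [Real.dist_eq, abs_lt] at *
  have m1 := ha.majorant_mono hr hlo0 (s := s r) (max_le (by linarith) (hs0 r hr))
  have m2 := ha.majorant_mono hr (hs0 r hr) (s := s t + η) (by linarith)
  constructor <;> linarith

end Majorant

/-! ### The differential equation of the radius -/

lemma hasDerivWithinAt_integral_Icc {G : ℝ → ℝ} {T : ℝ} (hG : ContinuousOn G (Icc 0 T)) {t : ℝ}
    (ht : t ∈ Icc 0 T) :
    HasDerivWithinAt (fun r => ∫ s in (0 : ℝ)..r, G s) (G t) (Icc 0 T) t := by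
  have hT : (0 : ℝ) ≤ T := ht.1.trans ht.2
  set G' : ℝ → ℝ := IccExtend hT ((Icc 0 T).domRestrict G) with hG'
  have hc : Continuous G' := (continuousOn_iff_continuous_domRestrict.1 hG).Icc_extend'
  have heq (r : ℝ) (hr : r ∈ Icc 0 T) : G' r = G r := by
    rw [hG', IccExtend_of_mem hT _ hr]; rfl
  have hint (r : ℝ) (hr : r ∈ Icc 0 T) : ∫ s in (0 : ℝ)..r, G s = ∫ s in (0 : ℝ)..r, G' s := by
    refine intervalIntegral.integral_congr fun s hs => ?_
    rw [uIcc_of_le hr.1] at hs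
    exact (heq s ⟨hs.1, hs.2.trans hr.2⟩).symm
  have hd := (hc.integral_hasStrictDerivAt 0 t).hasDerivAt.hasDerivWithinAt (s := Icc 0 T)
  rw [heq t ht] at hd
  exact hd.congr hint (hint t ht)

section Radius

variable {h : ℝ → ℝ} {τ₀ T : ℝ}

lemma radius_base_pos (hh : ∀ t ∈ Icc 0 T, 0 ≤ h t) (hτ₀ : 0 < τ₀) {t : ℝ} (ht : t ∈ Icc 0 T) :
    0 < 2 * (∫ s in (0 : ℝ)..t, h s) + τ₀ ^ (-2 : ℝ) := by
  have h1 : 0 ≤ ∫ s in (0 : ℝ)..t, h s :=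
    intervalIntegral.integral_nonneg ht.1 fun s hs => hh s ⟨hs.1, hs.2.trans ht.2⟩
  have h2 : 0 < τ₀ ^ (-2 : ℝ) := Real.rpow_pos_of_pos hτ₀ _
  linarith

lemma radius_pos (hh : ∀ t ∈ Icc 0 T, 0 ≤ h t) (hτ₀ : 0 < τ₀) {t : ℝ} (ht : t ∈ Icc 0 T) :
    0 < radius h τ₀ t :=
  Real.rpow_pos_of_pos (radius_base_pos hh hτ₀ ht) _

lemma radius_zero (h : ℝ → ℝ) (hτ₀ : 0 < τ₀) : radius h τ₀ 0 = τ₀ := by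
  rw [radius, intervalIntegral.integral_same, mul_zero, zero_add, ← Real.rpow_mul hτ₀.le]
  norm_num

lemma radius_le (hh : ∀ t ∈ Icc 0 T, 0 ≤ h t) (hτ₀ : 0 < τ₀) {t : ℝ} (ht : t ∈ Icc 0 T) :
    radius h τ₀ t ≤ τ₀ := by
  have h1 : 0 ≤ ∫ s in (0 : ℝ)..t, h s :=
    intervalIntegral.integral_nonneg ht.1 fun s hs => hh s ⟨hs.1, hs.2.trans ht.2⟩
  have h2 : 0 < τ₀ ^ (-2 : ℝ) := Real.rpow_pos_of_pos hτ₀ _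
  calc radius h τ₀ t ≤ (τ₀ ^ (-2 : ℝ)) ^ (-(1 / 2) : ℝ) :=
        Real.rpow_le_rpow_of_nonpos h2 (by linarith) (by norm_num)
    _ = τ₀ := by rw [← Real.rpow_mul hτ₀.le]; norm_num

lemma solvesRadiusODE_radius (hc : ContinuousOn h (Icc 0 T)) (hh : ∀ t ∈ Icc 0 T, 0 ≤ h t)
    (hτ₀ : 0 < τ₀) : SolvesRadiusODE h τ₀ T (radius h τ₀) := by
  refine ⟨radius_zero h hτ₀, fun t ht => ?_⟩
  have hpos := radius_base_pos hh hτ₀ ht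
  have hd := (((hasDerivWithinAt_integral_Icc hc ht).const_mul 2).add_const
    (τ₀ ^ (-2 : ℝ))).rpow_const (p := -(1 / 2)) (Or.inl hpos.ne')
  refine hd.congr_deriv ?_
  rw [radius, ← Real.rpow_natCast, ← Real.rpow_mul hpos.le]
  norm_num
  ring

lemma solvesRadiusODE_iff (hT : 0 ≤ T) (hc : ContinuousOn h (Icc 0 T))
    (hh : ∀ t ∈ Icc 0 T, 0 ≤ h t) (hτ₀ : 0 < τ₀) (τ : ℝ → ℝ) :
    SolvesRadiusODE h τ₀ T τ ↔ EqOn τ (radius h τ₀) (Icc 0 T) := by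
  have hrad := solvesRadiusODE_radius hc hh hτ₀
  constructor
  · intro hτ
    have hτc : ContinuousOn τ (Icc 0 T) := fun t ht => (hτ.2 t ht).continuousWithinAt
    have hrc : ContinuousOn (radius h τ₀) (Icc 0 T) :=
      fun t ht => (hrad.2 t ht).continuousWithinAt
    obtain ⟨A, hA⟩ := isCompact_Icc.exists_bound_of_continuousOn hτc
    obtain ⟨B, hB⟩ := isCompact_Icc.exists_bound_of_continuousOn hrc
    obtain ⟨M, hM⟩ := isCompact_Icc.exists_bound_of_continuousOn hc
    have h0 : (0 : ℝ) ∈ Icc 0 T := ⟨le_rfl, hT⟩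
    have hM0 : 0 ≤ M := (norm_nonneg _).trans (hM 0 h0)
    set R := max A B with hR
    have hright {f : ℝ → ℝ} (hf : ∀ t ∈ Icc 0 T,
        HasDerivWithinAt f (-(f t) ^ 3 * h t) (Icc 0 T) t) (t : ℝ) (ht : t ∈ Ico 0 T) :
        HasDerivWithinAt f (-(f t) ^ 3 * h t) (Ici t) t :=
      (hf t ⟨ht.1, ht.2.le⟩).mono_of_mem_nhdsWithin (Icc_mem_nhdsGE_of_mem ht)
    refine ODE_solution_unique_of_mem_Icc_right (v := fun t x => -x ^ 3 * h t)
      (s := fun _ => Metric.closedBall 0 R) (K := Real.toNNReal (3 * R ^ 2 * M))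
      (fun t ht => ?_) hτc (hright hτ.2) (fun t ht => ?_) hrc (hright hrad.2) (fun t ht => ?_)
      (hτ.1.trans hrad.1.symm)
    · refine LipschitzOnWith.of_dist_le_mul fun x hx y hy => ?_
      rw [mem_closedBall_zero_iff, Real.norm_eq_abs] at hx hy
      have hMt := hM t ⟨ht.1, ht.2.le⟩
      rw [Real.norm_eq_abs] at hMt
      rw [Real.coe_toNNReal _ (by positivity), Real.dist_eq, Real.dist_eq,
        show -x ^ 3 * h t - -y ^ 3 * h t = -((x ^ 2 + x * y + y ^ 2) * h t * (x - y)) by ring,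
        abs_neg, abs_mul, abs_mul]
      have hR0 : 0 ≤ R := (abs_nonneg x).trans hx
      have hq : |x ^ 2 + x * y + y ^ 2| ≤ 3 * R ^ 2 := by
        have h1 := sq_le_sq' (neg_le_of_abs_le hx) (le_of_abs_le hx)
        have h2 := sq_le_sq' (neg_le_of_abs_le hy) (le_of_abs_le hy)
        rw [abs_le]
        constructor <;> nlinarith [sq_nonneg (x + y), sq_nonneg (x - y)]
      gcongr
    · rw [mem_closedBall_zero_iff]
      exact (hA t ⟨ht.1, ht.2.le⟩).trans (le_max_left _ _)
    · rw [mem_closedBall_zero_iff]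
      exact (hB t ⟨ht.1, ht.2.le⟩).trans (le_max_right _ _)
  · intro heq
    refine ⟨(heq ⟨le_rfl, hT⟩).trans hrad.1, fun t ht => ?_⟩
    rw [heq ht]
    exact (hrad.2 t ht).congr heq (heq ht)

lemma le_radius_of_le_rpow (hc : ContinuousOn h (Icc 0 T)) (hh : ∀ t ∈ Icc 0 T, 0 ≤ h t)
    (hτ₀ : 0 < τ₀) {K α : ℝ} (hK : 0 ≤ K) (hα : 0 ≤ α)
    (hb : ∀ t ∈ Icc 0 T, h t ≤ K * (1 + t) ^ α) {t : ℝ} (ht : t ∈ Icc 0 T) :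
    (2 * K + τ₀ ^ (-2 : ℝ)) ^ (-(1 / 2) : ℝ) * (1 + t) ^ (-(α + 1) / 2) ≤ radius h τ₀ t := by
  have ht1 : 1 ≤ 1 + t := by linarith [ht.1]
  have hpow : 1 ≤ (1 + t) ^ (α + 1) := Real.one_le_rpow ht1 (by linarith)
  have h2 : 0 < τ₀ ^ (-2 : ℝ) := Real.rpow_pos_of_pos hτ₀ _
  have hint : ∫ s in (0 : ℝ)..t, h s ≤ K * (1 + t) ^ (α + 1) := by
    calc ∫ s in (0 : ℝ)..t, h s ≤ ∫ _ in (0 : ℝ)..t, K * (1 + t) ^ α := by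
          refine intervalIntegral.integral_mono_on ht.1 ?_ intervalIntegrable_const fun s hs => ?_
          · refine ContinuousOn.intervalIntegrable ?_
            rw [uIcc_of_le ht.1]
            exact hc.mono (Icc_subset_Icc_right ht.2)
          · refine (hb s ⟨hs.1, hs.2.trans ht.2⟩).trans ?_
            have := hs.1
            have := hs.2
            gcongr
      _ = K * ((1 + t) ^ α * t) := by
          rw [intervalIntegral.integral_const, smul_eq_mul]; ring
      _ ≤ K * ((1 + t) ^ α * (1 + t)) := by
          have : 0 ≤ (1 + t) ^ α := by positivity
          gcongr
          linarith
      _ = K * (1 + t) ^ (α + 1) := by rw [Real.rpow_add_one (by linarith)]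
  have e : (1 + t) ^ (-(α + 1) / 2) = ((1 + t) ^ (α + 1)) ^ (-(1 / 2) : ℝ) := by
    rw [← Real.rpow_mul (by linarith)]; congr 1; ring
  rw [e, ← Real.mul_rpow (by positivity) (by positivity)]
  refine Real.rpow_le_rpow_of_nonpos (radius_base_pos hh hτ₀ ht) ?_ (by norm_num)
  nlinarith

end Radius

/-! ### The energy estimate -/

/-- The part carried by the frequencies in `S` of the energy `‖A^p e^{τ𝒜} d‖² + ‖A^{p+1} e^{τ𝒜} c‖²`,
where `𝒜` is truncated to have the bounded symbol `min(|j'|, N)`. -/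
def truncEnergy {n : ℕ} (m : ℕ) (p N : ℝ) (S : Finset (Fin n → ℤ)) (τ : ℝ)
    (c d : (Fin n → ℤ) → ℂ) : ℝ :=
  ∑ j ∈ S, gevreyWeight m p τ N j ^ 2 * (‖d j‖ ^ 2 + bracket j * ‖c j‖ ^ 2)

/-- The dissipation `‖𝒜^{1/2} A^p e^{τ𝒜} d‖² + ‖𝒜^{1/2} A^{p+1} e^{τ𝒜} c‖²` gained from a decreasing
radius `τ`, with the truncations of `truncEnergy`. -/
def truncDissipation {n : ℕ} (m : ℕ) (p N : ℝ) (S : Finset (Fin n → ℤ)) (τ : ℝ)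
    (c d : (Fin n → ℤ) → ℂ) : ℝ :=
  ∑ j ∈ S, cutoff m N j *
    (gevreyWeight m p τ N j ^ 2 * (‖d j‖ ^ 2 + bracket j * ‖c j‖ ^ 2))

section Energy

variable {n m : ℕ} {p N τ : ℝ} {S : Finset (Fin n → ℤ)} {c d : (Fin n → ℤ) → ℂ}

lemma energy_term_nonneg (m : ℕ) (p N τ : ℝ) (c d : (Fin n → ℤ) → ℂ) (j : Fin n → ℤ) :
    0 ≤ gevreyWeight m p τ N j ^ 2 * (‖d j‖ ^ 2 + bracket j * ‖c j‖ ^ 2) := by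
  have := (bracket_pos j).le
  positivity

lemma truncDissipation_nonneg (hN : 0 ≤ N) : 0 ≤ truncDissipation m p N S τ c d :=
  Finset.sum_nonneg fun j _ => mul_nonneg (cutoff_nonneg m hN j) (energy_term_nonneg m p N τ c d j)

lemma truncDissipation_le : truncDissipation m p N S τ c d ≤ N * truncEnergy m p N S τ c d := by
  rw [truncEnergy, Finset.mul_sum]
  exact Finset.sum_le_sum fun j _ =>
    mul_le_mul_of_nonneg_right (min_le_right _ _) (energy_term_nonneg m p N τ c d j)

lemma sum_gevreyWeight_sq_le_truncEnergy :
    ∑ j ∈ S, gevreyWeight m p τ N j ^ 2 * ‖c j‖ ^ 2 ≤ truncEnergy m p N S τ c d := by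
  refine Finset.sum_le_sum fun j _ => mul_le_mul_of_nonneg_left ?_ (sq_nonneg _)
  nlinarith [one_le_bracket j, sq_nonneg ‖c j‖, sq_nonneg ‖d j‖]

lemma sum_gevreyWeight_sq_le_truncEnergy_snd :
    ∑ j ∈ S, gevreyWeight m p τ N j ^ 2 * ‖d j‖ ^ 2 ≤ truncEnergy m p N S τ c d := by
  refine Finset.sum_le_sum fun j _ => mul_le_mul_of_nonneg_left ?_ (sq_nonneg _)
  nlinarith [one_le_bracket j, sq_nonneg ‖c j‖, sq_nonneg ‖d j‖]

lemma exp_two_mul_le {x : ℝ} (hx : 0 ≤ x) :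
    Real.exp (2 * x) ≤ Real.exp 1 ^ 2 + x ^ 3 * Real.exp (2 * x) := by
  have h := Real.exp_pos (2 * x)
  rcases le_total x 1 with h1 | h1
  · have : Real.exp (2 * x) ≤ Real.exp 1 ^ 2 := by
      rw [← Real.exp_nat_mul]
      exact Real.exp_le_exp.2 (by push_cast; linarith)
    have : 0 ≤ x ^ 3 * Real.exp (2 * x) := by positivity
    linarith
  · have : 1 ≤ x ^ 3 := one_le_pow₀ h1
    nlinarith [sq_nonneg (Real.exp 1)]

/-- Interpolation between `H^p` and the dissipation: since `e^{2x} ≤ e² + x³ e^{2x}`, the norm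
`‖A^p e^{τ𝒜} c‖` is controlled by `‖c‖_{H^p}` and `τ³` times the dissipation. -/
lemma sum_gevreyWeight_sq_le_sobolevNorm (hN : 0 ≤ N) (hτ : 0 ≤ τ) (hc : MemSobolev p c) :
    ∑ j ∈ S, gevreyWeight m p τ N j ^ 2 * ‖c j‖ ^ 2 ≤
      Real.exp 1 ^ 2 * sobolevNorm p c ^ 2 + τ ^ 3 * truncDissipation m p N S τ c d := by
  have h1 : ∑ j ∈ S, ‖c j‖ ^ 2 * bracket j ^ p ≤ sobolevNorm p c ^ 2 := by
    rw [sobolevNorm_sq]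
    exact hc.sum_le_tsum S fun j _ => sobolev_term_nonneg p c j
  calc ∑ j ∈ S, gevreyWeight m p τ N j ^ 2 * ‖c j‖ ^ 2
      ≤ ∑ j ∈ S, (Real.exp 1 ^ 2 * (‖c j‖ ^ 2 * bracket j ^ p) + τ ^ 3 * (cutoff m N j *
          (gevreyWeight m p τ N j ^ 2 * (‖d j‖ ^ 2 + bracket j * ‖c j‖ ^ 2)))) := by
        refine Finset.sum_le_sum fun j _ => ?_
        have hμ := cutoff_nonneg m hN j
        have hx := exp_two_mul_le (mul_nonneg hτ hμ)
        have hb : 0 ≤ bracket j ^ p := Real.rpow_nonneg (bracket_pos j).le _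
        have hμ2 : cutoff m N j ^ 2 ≤ bracket j :=
          (pow_le_pow_left₀ hμ (min_le_left _ _) 2).trans (absFirst_sq_le_bracket m j)
        rw [gevreyWeight_sq, show 2 * τ * cutoff m N j = 2 * (τ * cutoff m N j) by ring]
        have hE := Real.exp_pos (2 * (τ * cutoff m N j))
        generalize Real.exp (2 * (τ * cutoff m N j)) = E at *
        generalize cutoff m N j = μ at *
        generalize bracket j ^ p = β at *
        have k1 := mul_le_mul_of_nonneg_left hx (mul_nonneg hb (sq_nonneg ‖c j‖))
        have k2 : τ ^ 3 * (μ * (β * E * (μ ^ 2 * ‖c j‖ ^ 2))) ≤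
            τ ^ 3 * (μ * (β * E * (‖d j‖ ^ 2 + bracket j * ‖c j‖ ^ 2))) := by
          gcongr
          have := mul_le_mul_of_nonneg_right hμ2 (sq_nonneg ‖c j‖)
          linarith [sq_nonneg ‖d j‖]
        linarith
    _ ≤ _ := by
        rw [Finset.sum_add_distrib, ← Finset.mul_sum, ← Finset.mul_sum]
        exact add_le_add_left (mul_le_mul_of_nonneg_left h1 (sq_nonneg _)) _

/-- The full weighted norm is that of the frequencies in `S` up to a Sobolev tail. -/
lemma weightedNormSq_gevreyWeight_le (hτ : 0 ≤ τ) (hc : MemSobolev p c) :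
    weightedNormSq (gevreyWeight m p τ N) c ≤
      ENNReal.ofReal (∑ j ∈ S, gevreyWeight m p τ N j ^ 2 * ‖c j‖ ^ 2 + Real.exp (2 * τ * N) *
        ∑' j : ↥((S : Set (Fin n → ℤ))ᶜ), ‖c j‖ ^ 2 * bracket (j : Fin n → ℤ) ^ p) := by
  have hle (j : Fin n → ℤ) : gevreyWeight m p τ N j ^ 2 * ‖c j‖ ^ 2 ≤
      Real.exp (2 * τ * N) * (‖c j‖ ^ 2 * bracket j ^ p) := by
    have hb := sobolev_term_nonneg p c j
    rw [gevreyWeight_sq]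
    calc _ = Real.exp (2 * τ * cutoff m N j) * (‖c j‖ ^ 2 * bracket j ^ p) := by ring
      _ ≤ _ := by
        gcongr
        exact min_le_right _ _
  have hsum : Summable fun j => gevreyWeight m p τ N j ^ 2 * ‖c j‖ ^ 2 :=
    Summable.of_nonneg_of_le (fun j => by positivity) hle (hc.mul_left _)
  have e : weightedNormSq (gevreyWeight m p τ N) c =
      ENNReal.ofReal (∑' j, gevreyWeight m p τ N j ^ 2 * ‖c j‖ ^ 2) := by
    rw [ENNReal.ofReal_tsum_of_nonneg (fun j => by positivity) hsum, weightedNormSq]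
    refine tsum_congr fun j => ?_
    rw [ENNReal.ofReal_mul (sq_nonneg _), ENNReal.ofReal_pow (gevreyWeight_pos m p τ N j).le,
      ENNReal.ofReal_pow (norm_nonneg _), ofReal_norm, mul_pow]
  rw [e, ← hsum.sum_add_tsum_compl (s := S), ← tsum_mul_left]
  exact ENNReal.ofReal_le_ofReal (add_le_add le_rfl (Summable.tsum_le_tsum (fun j => hle j)
    (hsum.subtype _) ((hc.subtype _).mul_left _)))

end Energy

/-- The derivative of the truncated energy along a solution: the energy identity, with the
contribution of the nonlinearity estimated. -/
lemma exists_hasDerivWithinAt_truncEnergy {n m : ℕ} {p N T : ℝ} {S : Finset (Fin n → ℤ)}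
    {c d w F : ℝ → (Fin n → ℤ) → ℂ} {τ : ℝ → ℝ} {τ' t : ℝ}
    (hc : ∀ j, HasDerivWithinAt (fun r => c r j) (d t j) (Icc 0 T) t)
    (hd : ∀ j, HasDerivWithinAt (fun r => d r j) (w t j) (Icc 0 T) t)
    (hτ : HasDerivWithinAt τ τ' (Icc 0 T) t)
    (heq : ∀ j, w t j + bracket j * c t j + F t j = 0) :
    ∃ D, HasDerivWithinAt (fun r => truncEnergy m p N S (τ r) (c r) (d r)) D (Icc 0 T) t ∧
      D ≤ 2 * τ' * truncDissipation m p N S (τ t) (c t) (d t) +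
        2 * ∑ j ∈ S, gevreyWeight m p (τ t) N j ^ 2 * (‖F t j‖ * ‖d t j‖) := by
  have hW (j : Fin n → ℤ) : HasDerivWithinAt (fun r => gevreyWeight m p (τ r) N j ^ 2)
      (2 * τ' * cutoff m N j * gevreyWeight m p (τ t) N j ^ 2) (Icc 0 T) t := by
    simp only [gevreyWeight_sq]
    refine ((((hτ.const_mul 2).mul_const (cutoff m N j)).exp).const_mul
      (bracket j ^ p)).congr_deriv ?_
    ring
  refine ⟨_, HasDerivWithinAt.fun_sum fun j _ => (hW j).mul
    ((hd j).norm_sq.add ((hc j).norm_sq.const_mul (bracket j))), ?_⟩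
  rw [truncDissipation, Finset.mul_sum, Finset.mul_sum, ← Finset.sum_add_distrib]
  refine Finset.sum_le_sum fun j _ => ?_
  have hin : inner ℝ (d t j) (w t j) + bracket j * inner ℝ (c t j) (d t j) ≤
      ‖F t j‖ * ‖d t j‖ := by
    have e : w t j = -(bracket j • c t j) - F t j := by
      rw [Complex.real_smul]
      linear_combination heq j
    rw [e, inner_sub_right, inner_neg_right, inner_smul_right, real_inner_comm (d t j) (c t j)]
    have := abs_real_inner_le_norm (d t j) (F t j)
    have := neg_abs_le (inner ℝ (d t j) (F t j))
    linarith
  have := mul_le_mul_of_nonneg_left hin (sq_nonneg (gevreyWeight m p (τ t) N j))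
  linarith

lemma add_sq_add_half_le {x η : ℝ} (hx : 0 ≤ x) (hη : 0 ≤ η) (hη1 : η ≤ 1 / 2) :
    (x + η) ^ 2 + 1 / 2 ≤ (√2 * x + 1) ^ 2 := by
  have h1 : x ≤ √2 * x := le_mul_of_one_le_left hx (Real.one_le_sqrt.2 (by norm_num))
  rw [add_sq (√2 * x), mul_pow, Real.sq_sqrt (by norm_num)]
  nlinarith [mul_nonneg hx (sub_nonneg.2 hη1), mul_nonneg hη (sub_nonneg.2 hη1), sq_nonneg x]

lemma sq_mul_sq_add_le {x y : ℝ} (hx : 0 ≤ x) (hy : 0 ≤ y) :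
    x ^ 2 * y ^ 2 + 1 + 1 / 2 ≤ (√2 * x * y + 2) ^ 2 := by
  have h1 : 0 ≤ √2 * x * y := by positivity
  rw [add_sq (√2 * x * y), mul_pow, mul_pow, Real.sq_sqrt (by norm_num)]
  nlinarith [mul_nonneg (sq_nonneg x) (sq_nonneg y)]

/-- The a priori bound for the truncated energy, uniform in the truncations `N` and `S`. Because `τ³`
times the dissipation is at most `τ₀³ N` times the energy, it can exceed `1` only where the energy is
bounded below; `hε2` makes the margin `ε (1 + t)` at most half the square root of that lower bound,
so that `ξ` is not small wherever the dissipation has to absorb the nonlinearity. -/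
lemma truncEnergy_le {n m : ℕ} {p lam T τ₀ N ε : ℝ} {S : Finset (Fin n → ℤ)}
    {a : (Fin n → ℤ) → ℕ → ℝ → ℂ} {u ut : ℝ → L2Torus n} {utt : ℝ → (Fin n → ℤ) → ℂ}
    {τ ξ h : ℝ → ℝ} (hpn : (n : ℝ) / 2 < p) (hp : 1 ≤ p) (hT : 0 ≤ T)
    (ha : MajorantAssumption m p lam T a)
    (hu : ∀ t ∈ Icc 0 T, MemSobolev p (coeff (u t)))
    (hd : ∀ j, ∀ t ∈ Icc 0 T,
      HasDerivWithinAt (fun r => coeff (u r) j) (coeff (ut t) j) (Icc 0 T) t)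
    (hdd : ∀ j, ∀ t ∈ Icc 0 T,
      HasDerivWithinAt (fun r => coeff (ut r) j) (utt t j) (Icc 0 T) t)
    (heq : ∀ t ∈ Icc 0 T, WeakEquation a t (u t) (utt t))
    (hτ : ∀ t ∈ Icc 0 T, HasDerivWithinAt τ (-(τ t) ^ 3 * h t) (Icc 0 T) t)
    (hτpos : ∀ t ∈ Icc 0 T, 0 < τ t) (hττ₀ : ∀ t ∈ Icc 0 T, τ t ≤ τ₀) (hτ₀ : τ₀ ≤ lam)
    (hξ : ∀ t ∈ Icc 0 T, HasDerivWithinAt ξ (2 * majorant m p lam a t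
      (algebraConst n p * (√2 * Real.exp 1 * sobolevNorm p (coeff (u t)) + 2))) (Icc 0 T) t)
    (hξ0 : ∀ t ∈ Icc 0 T, 0 ≤ ξ t)
    (hh : ∀ t ∈ Icc 0 T, h t = 2 * majorant m p lam a t (algebraConst n p * (√2 * ξ t + 1)) * ξ t)
    (hN : 0 ≤ N) (hε : 0 < ε) (hε1 : ε * (1 + T) ≤ 1 / 2)
    (hε2 : 4 * (ε * (1 + T)) ^ 2 * (τ₀ ^ 3 * N) ≤ 1)
    (hS : ∀ t ∈ Icc 0 T, Real.exp (2 * τ₀ * N) * ∑' j : ↥((S : Set (Fin n → ℤ))ᶜ),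
      ‖coeff (u t) j‖ ^ 2 * bracket (j : Fin n → ℤ) ^ p ≤ 1 / 2)
    (hinit : truncEnergy m p N S (τ 0) (coeff (u 0)) (coeff (ut 0)) ≤ ξ 0 ^ 2) :
    ∀ t ∈ Icc 0 T, truncEnergy m p N S (τ t) (coeff (u t)) (coeff (ut t)) ≤
      (ξ t + ε * (1 + t)) ^ 2 := by
  set X : ℝ → ℝ := fun t => truncEnergy m p N S (τ t) (coeff (u t)) (coeff (ut t)) with hX
  set Z : ℝ → ℝ := fun t => truncDissipation m p N S (τ t) (coeff (u t)) (coeff (ut t)) with hZ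
  -- Continuous representatives of `u(t)`, and the equation of each Fourier coefficient.
  have hrep (t : ℝ) (ht : t ∈ Icc 0 T) :=
    exists_continuous_rep (u t) (summable_of_memSobolev hpn (hu t ht))
  choose! V hVae hV using hrep
  set F : ℝ → (Fin n → ℤ) → ℂ := fun t => mFourierCoeff (fun x => nonlinearity a t x (V t x))
    with hF
  have hD (t : ℝ) (ht : t ∈ Icc 0 T) := exists_hasDerivWithinAt_truncEnergy (m := m) (p := p)
    (N := N) (S := S) (F := F) (fun j => hd j t ht) (fun j => hdd j t ht) (hτ t ht)
    fun j => (heq t ht).coeff_eq (hVae t ht) j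
  choose! D hDX hDle using hD
  have hξd (t : ℝ) (ht : t ∈ Icc 0 T) : HasDerivWithinAt (fun r => (ξ r + ε * (1 + r)) ^ 2)
      (2 * (ξ t + ε * (1 + t)) * (2 * majorant m p lam a t
        (algebraConst n p * (√2 * Real.exp 1 * sobolevNorm p (coeff (u t)) + 2)) + ε))
      (Icc 0 T) t := by
    have h1 : HasDerivWithinAt (fun r => ε * (1 + r)) ε (Icc 0 T) t := by
      simpa using (((hasDerivWithinAt_id t (Icc 0 T)).const_add 1).const_mul ε)
    refine (((hξ t ht).add h1).pow 2).congr_deriv ?_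
    simp
  have hright {f : ℝ → ℝ} {f' t : ℝ} (ht : t ∈ Ico 0 T) (hf : HasDerivWithinAt f f' (Icc 0 T) t) :
      HasDerivWithinAt f f' (Ici t) t := hf.mono_of_mem_nhdsWithin (Icc_mem_nhdsGE_of_mem ht)
  have hsub {t : ℝ} (ht : t ∈ Ico 0 T) : t ∈ Icc 0 T := ⟨ht.1, ht.2.le⟩
  have hC := algebraConst_nonneg n p
  -- It suffices to bound the derivative of the energy where it reaches the barrier.
  refine image_le_of_deriv_right_lt_deriv_boundary' (f := X) (f' := D)
    (fun t ht => (hDX t ht).continuousWithinAt) (fun t ht => hright ht (hDX t (hsub ht))) ?_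
    (fun t ht => (hξd t ht).continuousWithinAt) (fun t ht => hright ht (hξd t (hsub ht))) ?_
  · refine hinit.trans (pow_le_pow_left₀ (hξ0 0 ⟨le_rfl, hT⟩) ?_ 2)
    linarith
  intro t ht' hcross
  have ht := hsub ht'
  set η := ε * (1 + t) with hη
  have hηpos : 0 < η := mul_pos hε (by linarith [ht.1])
  have hηle : η ≤ ε * (1 + T) := mul_le_mul_of_nonneg_left (by linarith [ht.2]) hε.le
  have hξt := hξ0 t ht
  set y := ξ t + η with hy
  have hypos : 0 < y := by linarith
  have hZ0 : 0 ≤ Z t := truncDissipation_nonneg hN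
  have hZX : Z t ≤ N * X t := truncDissipation_le
  have hτt := hτpos t ht
  have hτ₀pos : 0 < τ₀ := hτt.trans_le (hττ₀ t ht)
  have hτ3 : 0 < τ t ^ 3 := by positivity
  have htail : Real.exp (2 * τ t * N) * ∑' j : ↥((S : Set (Fin n → ℤ))ᶜ),
      ‖coeff (u t) j‖ ^ 2 * bracket (j : Fin n → ℤ) ^ p ≤ 1 / 2 := by
    refine le_trans (mul_le_mul_of_nonneg_right ?_ (tsum_nonneg fun j =>
      sobolev_term_nonneg p (coeff (u t)) j)) (hS t ht)
    exact Real.exp_le_exp.2 (mul_le_mul_of_nonneg_right (by linarith [hττ₀ t ht]) hN)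
  have hweight := weightedNormSq_gevreyWeight_le (m := m) (N := N) (S := S) hτt.le (hu t ht)
  -- The contribution of the nonlinearity, for any bound `B` of `‖A^p e^{τ𝒜} u‖`.
  have hnl {B : ℝ} (hB : 0 ≤ B) (hle : ∑ j ∈ S, gevreyWeight m p (τ t) N j ^ 2 *
      ‖coeff (u t) j‖ ^ 2 + 1 / 2 ≤ B ^ 2) :
      D t ≤ 2 * (-(τ t) ^ 3 * h t) * Z t + 2 * (majorant m p lam a t (algebraConst n p * B) * y) := by
    have h1 := sum_norm_mFourierCoeff_nonlinearity_le m hpn hp hτt.le ((hττ₀ t ht).trans hτ₀) hN hB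
      (ha.summable t ht) (summable_of_memSobolev hpn (hu t ht)) (hV t ht)
      (hweight.trans (ENNReal.ofReal_le_ofReal (by linarith))) S (fun j => ‖coeff (ut t) j‖)
      fun _ => norm_nonneg _
    have h2 : √(∑ j ∈ S, gevreyWeight m p (τ t) N j ^ 2 * ‖coeff (ut t) j‖ ^ 2) ≤ y := by
      refine Real.sqrt_le_iff.2 ⟨hypos.le, ?_⟩
      rw [← hcross]
      exact sum_gevreyWeight_sq_le_truncEnergy_snd
    have h3 := mul_le_mul_of_nonneg_left h2
      (majorant_nonneg m p lam a t (mul_nonneg hC hB))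
    have := hDle t ht
    linarith
  have hE := Real.exp_pos 1
  have hs20 : 0 ≤ √(2 : ℝ) := Real.sqrt_nonneg 2
  have hu0 := sobolevNorm_nonneg p (coeff (u t))
  have hlow0 : 0 ≤ majorant m p lam a t
      (algebraConst n p * (√2 * Real.exp 1 * sobolevNorm p (coeff (u t)) + 2)) :=
    majorant_nonneg m p lam a t (by positivity)
  have hhigh0 : 0 ≤ majorant m p lam a t (algebraConst n p * (√2 * ξ t + 1)) :=
    majorant_nonneg m p lam a t (by positivity)
  rcases le_or_gt (τ t ^ 3 * Z t) 1 with hcase | hcase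
  · -- Little dissipation: `‖A^p e^{τ𝒜} u‖` is bounded in terms of the Sobolev norm.
    have h1 := sum_gevreyWeight_sq_le_sobolevNorm (m := m) (S := S) (d := coeff (ut t)) hN hτt.le
      (hu t ht)
    have h2 := hnl (B := √2 * Real.exp 1 * sobolevNorm p (coeff (u t)) + 2) (by positivity)
      ((by linarith : _ ≤ _).trans (sq_mul_sq_add_le hE.le hu0))
    have h3 : 0 ≤ τ t ^ 3 * h t * Z t := by
      rw [hh t ht]; positivity
    have h4 : 0 < y * ε + y * majorant m p lam a t
        (algebraConst n p * (√2 * Real.exp 1 * sobolevNorm p (coeff (u t)) + 2)) :=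
      add_pos_of_pos_of_nonneg (mul_pos hypos hε) (mul_nonneg hypos.le hlow0)
    linarith
  · -- Much dissipation: it absorbs the nonlinearity, as `y ≤ 2 ξ`.
    have hκ : τ t ^ 3 * Z t ≤ τ₀ ^ 3 * N * y ^ 2 := by
      rw [← hcross, mul_assoc]
      have := hττ₀ t ht
      have := hτ₀pos
      gcongr
    have hy2 : y ≤ 2 * ξ t := by
      by_contra! hlt
      have h1 : y ≤ 2 * (ε * (1 + T)) := by linarith
      have h2 : y ^ 2 ≤ 4 * (ε * (1 + T)) ^ 2 := by
        linarith [pow_le_pow_left₀ hypos.le h1 2]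
      have h3 : 0 ≤ τ₀ ^ 3 * N := by positivity
      linarith [mul_le_mul_of_nonneg_left h2 h3]
    have h1 : ∑ j ∈ S, gevreyWeight m p (τ t) N j ^ 2 * ‖coeff (u t) j‖ ^ 2 ≤ y ^ 2 := by
      rw [← hcross]; exact sum_gevreyWeight_sq_le_truncEnergy
    have h2 := hnl (B := √2 * ξ t + 1) (by positivity)
      ((by linarith : _ ≤ _).trans (add_sq_add_half_le hξt hηpos.le (hηle.trans hε1)))
    have h3 : y * majorant m p lam a t (algebraConst n p * (√2 * ξ t + 1)) ≤
        τ t ^ 3 * h t * Z t := by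
      rw [hh t ht]
      calc _ ≤ (2 * ξ t) * majorant m p lam a t (algebraConst n p * (√2 * ξ t + 1)) * 1 := by
            rw [mul_one]; gcongr
        _ ≤ (2 * ξ t) * majorant m p lam a t (algebraConst n p * (√2 * ξ t + 1)) *
              (τ t ^ 3 * Z t) := by gcongr
        _ = _ := by ring
    have h4 : 0 < y * (2 * majorant m p lam a t
      (algebraConst n p * (√2 * Real.exp 1 * sobolevNorm p (coeff (u t)) + 2)) + ε) := by positivity
    linarith

/-! ### Passage to the limit in the truncations -/


lemma gevreyNorm_sq {n : ℕ} (m : ℕ) (q τ : ℝ) (v : L2Torus n) : gevreyNorm m q τ v ^ 2 =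
    ∑' j, ‖coeff v j‖ ^ 2 * bracket j ^ q * Real.exp (2 * τ * absFirst m j) :=
  Real.sq_sqrt (tsum_nonneg fun j => mul_nonneg (sobolev_term_nonneg q (coeff v) j)
    (Real.exp_pos _).le)

lemma MemGevrey.mono {n m : ℕ} {q σ τ : ℝ} (hτσ : τ ≤ σ) {v : L2Torus n}
    (hv : MemGevrey m q σ v) : MemGevrey m q τ v := by
  refine Summable.of_nonneg_of_le (fun j => mul_nonneg (sobolev_term_nonneg q (coeff v) j)
    (Real.exp_pos _).le) (fun j => mul_le_mul_of_nonneg_left ?_ (sobolev_term_nonneg q (coeff v) j))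
    hv
  have := absFirst_nonneg m j
  gcongr

/-- The Gevrey energy of the initial data dominates all its truncations. -/
lemma truncEnergy_le_initialSize_sq {n m : ℕ} {p N τ₀ : ℝ} (S : Finset (Fin n → ℤ))
    {u₀ u₁ : L2Torus n} (hτ₀ : 0 ≤ τ₀) (h₀ : MemGevrey m (p + 1) τ₀ u₀)
    (h₁ : MemGevrey m p τ₀ u₁) :
    truncEnergy m p N S τ₀ (coeff u₀) (coeff u₁) ≤ initialSize m p τ₀ u₀ u₁ ^ 2 := by
  rw [initialSize, Real.sq_sqrt (by positivity), gevreyNorm_sq, gevreyNorm_sq,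
    ← Summable.tsum_add h₁ h₀]
  have hterm (j : Fin n → ℤ) : gevreyWeight m p τ₀ N j ^ 2 *
      (‖coeff u₁ j‖ ^ 2 + bracket j * ‖coeff u₀ j‖ ^ 2) ≤
      ‖coeff u₁ j‖ ^ 2 * bracket j ^ p * Real.exp (2 * τ₀ * absFirst m j) +
      ‖coeff u₀ j‖ ^ 2 * bracket j ^ (p + 1) * Real.exp (2 * τ₀ * absFirst m j) := by
    have hb := bracket_pos j
    have hE : Real.exp (2 * τ₀ * cutoff m N j) ≤ Real.exp (2 * τ₀ * absFirst m j) := by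
      gcongr
      exact min_le_left _ _
    rw [gevreyWeight_sq, Real.rpow_add_one hb.ne']
    have hbp : 0 ≤ bracket j ^ p := Real.rpow_nonneg hb.le _
    have := mul_le_mul_of_nonneg_right hE (show 0 ≤ bracket j ^ p *
      (‖coeff u₁ j‖ ^ 2 + bracket j * ‖coeff u₀ j‖ ^ 2) by positivity)
    linarith
  exact (Finset.sum_le_sum fun j _ => hterm j).trans ((h₁.add h₀).sum_le_tsum S fun j _ =>
    (energy_term_nonneg m p N τ₀ _ _ j).trans (hterm j))

/-- A bound of the energies uniform in all truncations gives Gevrey regularity. -/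
lemma memGevrey_of_truncEnergy_le {n m : ℕ} {p τ R : ℝ} {v w : L2Torus n}
    (h : ∀ S₀ : Finset (Fin n → ℤ), ∃ N S, (∀ j ∈ S₀, absFirst m j ≤ N) ∧ S₀ ⊆ S ∧
      truncEnergy m p N S τ (coeff v) (coeff w) ≤ R) :
    MemGevrey m (p + 1) τ v ∧ MemGevrey m p τ w := by
  have hsum : Summable fun j : Fin n → ℤ => bracket j ^ p * Real.exp (2 * τ * absFirst m j) *
      (‖coeff w j‖ ^ 2 + bracket j * ‖coeff v j‖ ^ 2) := by
    refine summable_of_sum_le (c := R) (fun j => ?_) fun S₀ => ?_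
    · have := Real.rpow_nonneg (bracket_pos j).le p
      have := (bracket_pos j).le
      positivity
    · obtain ⟨N, S, hN, hS, hle⟩ := h S₀
      refine le_trans ?_ hle
      refine le_trans (Finset.sum_le_sum fun j hj => ?_)
        (Finset.sum_le_sum_of_subset_of_nonneg hS fun j _ _ => energy_term_nonneg m p N τ _ _ j)
      rw [gevreyWeight_sq, cutoff, min_eq_left (hN j hj)]
  constructor <;> refine Summable.of_nonneg_of_le (fun j => mul_nonneg
    (sobolev_term_nonneg _ _ j) (Real.exp_pos _).le) (fun j => ?_) hsum
  · have : 0 ≤ bracket j ^ p * Real.exp (2 * τ * absFirst m j) * ‖coeff w j‖ ^ 2 := by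
      have := Real.rpow_nonneg (bracket_pos j).le p
      positivity
    rw [Real.rpow_add_one (bracket_pos j).ne']
    linarith
  · have : 0 ≤ bracket j ^ p * Real.exp (2 * τ * absFirst m j) *
        (bracket j * ‖coeff v j‖ ^ 2) := by
      have := Real.rpow_nonneg (bracket_pos j).le p
      have := (bracket_pos j).le
      positivity
    linarith

end GevreyWave

end

open GevreyWave in
theorem theorem1 (n : ℕ) (p : ℝ) (hn : 1 ≤ n) (hpn : (n : ℝ) / 2 < p) (hp1 : 1 ≤ p) :
    ∃ C₁ : ℝ, 0 < C₁ ∧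
      ∀ (m : ℕ) (T lam σ : ℝ) (a : (Fin n → ℤ) → ℕ → ℝ → ℂ)
        (u₀ u₁ : L2Torus n) (u ut : ℝ → L2Torus n),
        1 ≤ m → m ≤ n → 0 < T → 0 < lam → 0 < σ →
        MajorantAssumption m p lam T a →
        MemGevrey m (p + 1) σ u₀ → MemGevrey m p σ u₁ →
        IsSolution a T p u₀ u₁ u ut →
        ∀ (τ₀ : ℝ) (h : ℝ → ℝ), τ₀ = min σ lam → h = decayRate C₁ m p lam τ₀ a u₀ u₁ u →
          (∀ t ∈ Set.Icc 0 T, 0 ≤ h t) ∧ ContinuousOn h (Set.Icc 0 T) ∧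
          (∀ τ : ℝ → ℝ, SolvesRadiusODE h τ₀ T τ ↔ Set.EqOn τ (radius h τ₀) (Set.Icc 0 T)) ∧
          (∀ t ∈ Set.Icc 0 T, MemGevrey m (p + 1) (radius h τ₀ t) (u t) ∧
            MemGevrey m p (radius h τ₀ t) (ut t)) ∧
          (∀ K α : ℝ, 0 ≤ K → 0 ≤ α → (∀ t ∈ Set.Icc 0 T, h t ≤ K * (1 + t) ^ α) →
            ∀ t ∈ Set.Icc 0 T,
              (2 * K + τ₀ ^ (-2 : ℝ)) ^ (-(1 / 2) : ℝ) * (1 + t) ^ (-(α + 1) / 2) ≤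
                radius h τ₀ t) := by
  refine ⟨2, two_pos, fun m T lam σ a u₀ u₁ u ut _ _ hT hlam hσ ha hu₀ hu₁ hsol τ₀ h hτ₀ hh => ?_⟩
  obtain ⟨hinit₀, hinit₁, hu, hut, hdu, utt, hutt, hdut, hweak⟩ := hsol
  have hτ₀pos : 0 < τ₀ := hτ₀ ▸ lt_min hσ hlam
  have hτ₀σ : τ₀ ≤ σ := hτ₀ ▸ min_le_left _ _
  have hτ₀lam : τ₀ ≤ lam := hτ₀ ▸ min_le_right _ _
  have hC := algebraConst_nonneg n p
  have hT0 : (0 : ℝ) ∈ Set.Icc 0 T := ⟨le_rfl, hT.le⟩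
  set G : ℝ → ℝ := fun s => majorant m p lam a s
    (algebraConst n p * (√2 * Real.exp 1 * sobolevNorm p (coeff (u s)) + 2)) with hG
  set ξ : ℝ → ℝ := xi 2 m p lam τ₀ a u₀ u₁ u with hξdef
  have hGarg (t : ℝ) :
      0 ≤ algebraConst n p * (√2 * Real.exp 1 * sobolevNorm p (coeff (u t)) + 2) := by
    have := sobolevNorm_nonneg p (coeff (u t))
    positivity
  have hGc : ContinuousOn G (Set.Icc 0 T) := by
    refine ha.continuousOn_majorant_comp ?_ fun t _ => hGarg t
    have := hu.continuousOn_sobolevNorm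
    fun_prop
  have hG0 (t : ℝ) : 0 ≤ G t := majorant_nonneg m p lam a t (hGarg t)
  have hξ (t : ℝ) (ht : t ∈ Set.Icc 0 T) : HasDerivWithinAt ξ (2 * G t) (Set.Icc 0 T) t :=
    ((hasDerivWithinAt_integral_Icc hGc ht).const_mul 2).const_add (initialSize m p τ₀ u₀ u₁)
  have hξ0 (t : ℝ) (ht : t ∈ Set.Icc 0 T) : 0 ≤ ξ t :=
    add_nonneg (Real.sqrt_nonneg _) (mul_nonneg zero_le_two
      (intervalIntegral.integral_nonneg ht.1 fun s _ => hG0 s))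
  have hξc : ContinuousOn ξ (Set.Icc 0 T) := fun t ht => (hξ t ht).continuousWithinAt
  have harg (t : ℝ) (ht : t ∈ Set.Icc 0 T) : 0 ≤ algebraConst n p * (√2 * ξ t + 1) := by
    have := hξ0 t ht
    positivity
  have hheq (t : ℝ) :
      h t = 2 * majorant m p lam a t (algebraConst n p * (√2 * ξ t + 1)) * ξ t := by
    rw [hh]; rfl
  have hh0 (t : ℝ) (ht : t ∈ Set.Icc 0 T) : 0 ≤ h t := by
    rw [hheq]
    have := majorant_nonneg m p lam a t (harg t ht)
    have := hξ0 t ht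
    positivity
  have hhc : ContinuousOn h (Set.Icc 0 T) := by
    have h1 := ha.continuousOn_majorant_comp
      (s := fun t => algebraConst n p * (√2 * ξ t + 1)) (by fun_prop) harg
    exact ((continuousOn_const.mul h1).mul hξc).congr fun t _ => hheq t
  have hrad := solvesRadiusODE_radius hhc hh0 hτ₀pos
  refine ⟨hh0, hhc, solvesRadiusODE_iff hT.le hhc hh0 hτ₀pos, fun t ht => ?_,
    fun K α hK hα hb t ht => le_radius_of_le_rpow hhc hh0 hτ₀pos hK hα hb ht⟩
  refine memGevrey_of_truncEnergy_le (R := (ξ t + 1) ^ 2) fun S₀ => ?_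
  have hN : 0 ≤ ∑ j ∈ S₀, absFirst m j := Finset.sum_nonneg fun j _ => absFirst_nonneg m j
  set N : ℝ := ∑ j ∈ S₀, absFirst m j with hNdef
  set κ : ℝ := τ₀ ^ 3 * N with hκ
  have hκ0 : 0 ≤ κ := by positivity
  -- With this margin, `4 (ε (1 + T))² κ = κ / (1 + κ)² ≤ 1`.
  set ε : ℝ := 1 / (2 * (1 + κ)) / (1 + T) with hε
  have hεT : ε * (1 + T) = 1 / (2 * (1 + κ)) := div_mul_cancel₀ _ (by positivity)
  have hε0 : 0 < ε := by positivity
  have hε1 : ε * (1 + T) ≤ 1 / 2 := by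
    rw [hεT]
    exact one_div_le_one_div_of_le two_pos (by linarith)
  -- The frequencies in `S` carry the norm of `u` in `H^p` up to a small tail, at all times.
  obtain ⟨S₁, hS₁⟩ := hu.exists_tail_le (ε := 1 / 2 * Real.exp (-(2 * τ₀ * N))) (by positivity)
  classical
  refine ⟨N, S₀ ∪ S₁, fun j hj => Finset.single_le_sum (f := fun j => absFirst m j)
    (fun i _ => absFirst_nonneg m i) hj, Finset.subset_union_left, ?_⟩
  have hutt' (r : ℝ) (hr : r ∈ Set.Icc 0 T) := (hut.1 r hr).mono (r := p - 2) (by linarith)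
  have key := truncEnergy_le (S := S₀ ∪ S₁) (N := N) (ε := ε) (h := h) (ξ := ξ) hpn hp1 hT.le ha
    hu.1
    (fun j r hr => hdu.hasDerivWithinAt_coeff (fun s hs => (hu.1 s hs).mono (by linarith)) hut.1
      j hr)
    (fun j r hr => hdut.hasDerivWithinAt_coeff hutt' hutt.1 j hr)
    hweak hrad.2 (fun r hr => radius_pos hh0 hτ₀pos hr) (fun r hr => radius_le hh0 hτ₀pos hr)
    hτ₀lam hξ hξ0 (fun r _ => hheq r) hN hε0 hε1 ?_ (fun r hr => ?_) ?_ t ht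
  · refine key.trans (pow_le_pow_left₀ ?_ ?_ 2)
    · have := hξ0 t ht
      have := ht.1
      positivity
    · have : ε * (1 + t) ≤ ε * (1 + T) := mul_le_mul_of_nonneg_left (by linarith [ht.2]) hε0.le
      linarith
  · rw [hεT, ← hκ, div_pow, one_pow, mul_one_div, div_mul_eq_mul_div, div_le_one (by positivity)]
    nlinarith
  · calc _ ≤ Real.exp (2 * τ₀ * N) * (1 / 2 * Real.exp (-(2 * τ₀ * N))) :=
          mul_le_mul_of_nonneg_left (hS₁ _ Finset.subset_union_right r hr) (Real.exp_pos _).le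
      _ = 1 / 2 := by
          rw [mul_left_comm, ← Real.exp_add, add_neg_cancel, Real.exp_zero, mul_one]
  · have e : ξ 0 = initialSize m p τ₀ u₀ u₁ := by simp [hξdef, xi]
    rw [radius_zero h hτ₀pos, hinit₀, hinit₁, e]
    exact truncEnergy_le_initialSize_sq _ hτ₀pos.le (hu₀.mono hτ₀σ) (hu₁.mono hτ₀σ)
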